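/- **Language.** Fix a finite set of field names. Variables are formals $\mathtt{arg}_i$ or locals; access paths are $\pi=x.\bar f$ with $\bar f$ a non-empty field sequence; an expression is a variable or a path. Write $e\preccurlyeq e'$ if $e,e'$ have the same root variable and the field sequence of $e$ is a prefix of that of $e'$, and $e\prec e'$ if moreover $e\ne e'$. Simple commands are $\mathsf{skip}$, $x:=y$, $x:=\pi$ (load), $\pi:=x$ (store), $x:=\mathsf{new}()$, $\mathsf{lock}()$, $\mathsf{unlock}()$; programs are $C::=c\mid C;c\mid C;\mathsf{if}\,*\,C_1\,C_2\mid C;\mathsf{while}\,*\,C'\mid C;m(e_1,\dots,e_n)$. Branching and looping are non-deterministic. Methods are non-recursive and call-by-value; their bodies mention only their own formals and initialise locals before use; calls have the right number of arguments. There is a single reentrant lock with contexts in $\mathbb N$; $L\oplus L'=\min(L+L',\hat L)$ for a fixed $\hat L\ge1$. Locking is balanced: in the program and in every branch, loop body and body of a called method, each $\mathsf{unlock}()$ closes a $\mathsf{lock}()$ of the same block and each $\mathsf{lock}()$ is closed in that block; the nesting depth (through calls) never exceeds $\hat L$. **Semantics.** A stack maps variables to locations; a heap is a finite partial map from addresses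 $(\ell,f)$ to locations, undefined at $\ell=\mathsf{nil}$. The address of $x.f$ in $(s,h)$ is $(s(x),f)$; that of $\pi.f$ is $(h(a),f)$ with $a$ the address of $\pi$. Loads and stores need their address to be allocated; $\mathsf{new}$ picks a non-nil location $\ell$ that is not allocated and sets $h(\ell,f)=\ell$ for all $f$; $\mathsf{lock}$ replaces $L$ by $L\oplus1$; $\mathsf{unlock}$ needs $L>0$ and decrements it. A call executes a command $\mathsf{push}(\bar e)$ (new frame: formals get the values of the arguments, every other variable is $\mathsf{nil}$), the body, and $\mathsf{pop}$. $\mathsf{skip}$ contributes no step. Traces of $C_1\parallel C_2$ are the prefixes of interleavings of the command sequences of complete executions of $C_1$ and of $C_2$ from the initial state, executed on a shared heap; each entry records a thread's command and the two-thread state in which it is about to be executed, and the last recorded command need not be executed. A thread with lock context $L$ may make a step to $L'$ only if the other thread's lock context is $0$ or $L=L'=0$. A two-thread state is *well-behaved* if all stack values and all heap values are allocated locations. A trace $\tau$ *races* if there are a two-thread state $\kappa$, with current frames $s_1,s_2$ and heap $h$, and commands $c'_1,c'_2$ such that $\tau$ extended by thread 1's next command $c'_1$ in $\kappa$ and $\tau$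 extended by thread 2's next command $c'_2$ in $\kappa$ are both traces, each $c'_i$ is a load from or a store to a path $\rho_i$, at least one of them is a store, and $\rho_1$ in $(s_1,h)$ and $\rho_2$ in $(s_2,h)$ have the same address. **Analysis.** An abstract state is $\langle W,L,A\rangle$: a set of (wobbly) expressions, a lock context, and a set of pairs $\langle c,L\rangle$ of a load or store and a lock context. Let $(\cdot)^{\mathsf{fml}}$ keep only expressions (or accesses to paths) rooted at formals, and $\langle W_1,L_1,A_1\rangle\sqcup\langle W_2,L_2,A_2\rangle=\langle W_1\cup W_2,\max(L_1,L_2),A_1\cup A_2\rangle$. For simple commands, $[\![c]\!]^\sharp$ adds $\{x,e\}^{\mathsf{fml}}$ to $W$ for $x:=e$ and $e:=x$, and $\{x\}^{\mathsf{fml}}$ for $x:=\mathsf{new}()$; replaces $L$ by $L\oplus1$ for $\mathsf{lock}$ and by $\max(L-1,0)$ for $\mathsf{unlock}$; and adds $\{\langle c,L\rangle\}^{\mathsf{fml}}$ to $A$ for loads and stores. $[\![C;c]\!]^\sharp=[\![c]\!]^\sharp\circ[\![C]\!]^\sharp$; with $D'=[\![C]\!]^\sharp D$, $[\![C;\mathsf{if}*C_1C_2]\!]^\sharp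 D=[\![C_1]\!]^\sharp D'\sqcup[\![C_2]\!]^\sharp D'$ and $[\![C;\mathsf{while}*C']\!]^\sharp D=D'\sqcup[\![C']\!]^\sharp D'$. For a call, let $\langle W',L',A'\rangle=[\![\mathrm{body}(m)]\!]^\sharp\bot$ with $\bot=\langle\emptyset,0,\emptyset\rangle$, and let $\theta$ replace the root $\mathtt{arg}_i$ by $e_i$ (in accesses, only in the path); then $[\![C;m(\bar e)]\!]^\sharp D$ is obtained from $\langle W,L,A\rangle=D'$ by adding $(\{e_i\mid\exists j\ne i.\ e_i\preccurlyeq e_j\}\cup W'\theta)^{\mathsf{fml}}$ to $W$, replacing $L$ by $L\oplus L'$, and adding $\{\langle c\theta,L\oplus L_c\rangle\mid\langle c,L_c\rangle\in A'\}^{\mathsf{fml}}$ to $A$. **Theorem (True Positives Theorem).** Let $C_1,C_2$ be programs as above with $[\![C_i]\!]^\sharp\bot=\langle W_i,\_,A_i\rangle$. Let $\langle c_i,L_i\rangle\in A_i$ ($i=1,2$) be accesses to paths $\pi_1=v_1.\bar f$ and $\pi_2=v_2.\bar f$ with the same field sequence $\bar f$, at least one of $c_1,c_2$ a store, such that $L_1+L_2\le1$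 and no $e\in W_i$ satisfies $e\prec\pi_i$ ($i=1,2$). Then there are stacks $s_1,s_2$ and a heap $h$ such that the two-thread state $\langle(s_1,s_2),h,(0,0)\rangle$ is well-behaved, and a trace of $C_1\parallel C_2$ from this state that races. -/

import Mathlib

namespace RacerDX

/-! ## Syntax -/

/-- Variables: method formals `arg i` (numbered from `0`) and local variables. -/
inductive Var where
  | arg (i : ℕ)
  | loc (n : ℕ)
  deriving DecidableEq

/-- The variable is a formal. -/
def Var.IsFormal : Var → Prop
  | .arg _ => True
  | .loc _ => False

/-- Access paths `x.f` and `π.f`. -/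
inductive Path (F : Type*) where
  | base (x : Var) (f : F)
  | field (π : Path F) (f : F)

/-- Expressions: variables and access paths. -/
inductive Exp (F : Type*) where
  | var (x : Var)
  | path (π : Path F)

/-- Simple commands of source programs. -/
inductive Cmd (F : Type*) where
  | skip
  | assign (x y : Var)
  | load (x : Var) (π : Path F)
  | store (π : Path F) (x : Var)
  | alloc (x : Var)
  | lock
  | unlock

/-- Simple commands that occur in execution traces: the source ones and the two runtime
commands that manipulate the call-stack. -/
inductive RCmd (F : Type*) where
  | base (c : Cmd F)
  | push (es : List (Exp F))
  | pop

/-- Compound programs: `c`, `C; c`, `C; if * C₁ C₂`, `C; while * C'` and `C; m(e₁, …, eₙ)`. -/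
inductive CStmt (M F : Type*) where
  | cmd (c : Cmd F)
  | seq (C : CStmt M F) (c : Cmd F)
  | ite (C C₁ C₂ : CStmt M F)
  | loop (C C' : CStmt M F)
  | call (C : CStmt M F) (m : M) (es : List (Exp F))

section
variable {M F : Type*}

/-- The root variable of a path. -/
def Path.root : Path F → Var
  | .base x _ => x
  | .field π _ => π.root

/-- The field sequence of a path. -/
def Path.fields : Path F → List F
  | .base _ f => [f]
  | .field π f => π.fields ++ [f]

/-- The root variable of an expression. -/
def Exp.root : Exp F → Var
  | .var x => x
  | .path π => π.root

/-- The field sequence of an expression (empty for a variable). -/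
def Exp.fields : Exp F → List F
  | .var _ => []
  | .path π => π.fields

/-- The prefix order `e ≼ e'` on expressions. -/
def Exp.Prefix (e e' : Exp F) : Prop :=
  e.root = e'.root ∧ e.fields <+: e'.fields

/-- The proper prefix order `e ≺ e'` on expressions. -/
def Exp.ProperPrefix (e e' : Exp F) : Prop :=
  e.Prefix e' ∧ e ≠ e'

/-- The path `e.f`. -/
def Exp.extend : Exp F → F → Path F
  | .var x, f => .base x f
  | .path π, f => .field π f

/-- Replace the root of a path; undefined if the substitution is undefined on the root. -/
def Path.subst (θ : Var → Option (Exp F)) : Path F → Option (Path F)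
  | .base x f => (θ x).map (fun e => e.extend f)
  | .field π f => (π.subst θ).map (fun ρ => .field ρ f)

/-- Replace the root of an expression; undefined if the substitution is undefined on the root. -/
def Exp.subst (θ : Var → Option (Exp F)) : Exp F → Option (Exp F)
  | .var x => θ x
  | .path π => (π.subst θ).map .path

/-- The substitution of the actuals `es` for the formals. -/
def actuals (es : List (Exp F)) : Var → Option (Exp F)
  | .arg i => es[i]?
  | .loc _ => none

/-! ## Methods and standing assumptions on programs -/

/-- The methods called in (the text of) a program. -/
def CStmt.calls : CStmt M F → Set M
  | .cmd _ => ∅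
  | .seq C _ => C.calls
  | .ite C C₁ C₂ => C.calls ∪ C₁.calls ∪ C₂.calls
  | .loop C C' => C.calls ∪ C'.calls
  | .call C m _ => C.calls ∪ {m}

/-- Every call passes as many actuals as the callee has formals. -/
def CStmt.ArityOK (arity : M → ℕ) : CStmt M F → Prop
  | .cmd _ => True
  | .seq C _ => C.ArityOK arity
  | .ite C C₁ C₂ => C.ArityOK arity ∧ C₁.ArityOK arity ∧ C₂.ArityOK arity
  | .loop C C' => C.ArityOK arity ∧ C'.ArityOK arity
  | .call C m es => C.ArityOK arity ∧ es.length = arity m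

/-- The variables whose value a simple command uses. -/
def Cmd.uses : Cmd F → Set Var
  | .assign _ y => {y}
  | .load _ π => {π.root}
  | .store π x => {π.root, x}
  | .skip | .alloc _ | .lock | .unlock => ∅

/-- The variables that a simple command assigns. -/
def Cmd.assigned : Cmd F → Set Var
  | .assign x _ => {x}
  | .load x _ => {x}
  | .alloc x => {x}
  | .skip | .store _ _ | .lock | .unlock => ∅

/-- The variables that occur in a program. -/
def CStmt.vars : CStmt M F → Set Var
  | .cmd c => c.uses ∪ c.assigned
  | .seq C c => C.vars ∪ (c.uses ∪ c.assigned)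
  | .ite C C₁ C₂ => C.vars ∪ C₁.vars ∪ C₂.vars
  | .loop C C' => C.vars ∪ C'.vars
  | .call C _ es => C.vars ∪ {x | ∃ e ∈ es, e.root = x}

/-- The variables that are definitely initialised after the program, if those in `I` are
before it. -/
def CStmt.initialised (I : Set Var) : CStmt M F → Set Var
  | .cmd c => I ∪ c.assigned
  | .seq C c => C.initialised I ∪ c.assigned
  | .ite C C₁ C₂ => C₁.initialised (C.initialised I) ∩ C₂.initialised (C.initialised I)
  | .loop C _ => C.initialised I
  | .call C _ _ => C.initialised I

/-- Every variable is definitely initialised before it is used, if those in `I` are initialised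
at the start. -/
def CStmt.InitOK (I : Set Var) : CStmt M F → Prop
  | .cmd c => c.uses ⊆ I
  | .seq C c => C.InitOK I ∧ c.uses ⊆ C.initialised I
  | .ite C C₁ C₂ =>
      C.InitOK I ∧ C₁.InitOK (C.initialised I) ∧ C₂.InitOK (C.initialised I)
  | .loop C C' => C.InitOK I ∧ C'.InitOK (C.initialised I)
  | .call C _ es => C.InitOK I ∧ ∀ e ∈ es, e.root ∈ C.initialised I

end

/-- Arities and bodies of the methods. The methods are not recursive: there is no infinite
chain of methods each of which calls the next. -/
structure MethodTable (M F : Type*) where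
  arity : M → ℕ
  body : M → CStmt M F
  acyclic : WellFounded (fun m' m => m' ∈ (body m).calls)

section
variable {M F : Type*}

/-- The conventions on method bodies: `m` mentions no formal besides its own, calls methods with
the right number of actuals, and does not use a local variable before it is initialised. -/
structure MethodTable.WellFormed (P : MethodTable M F) : Prop where
  formals : ∀ m i, Var.arg i ∈ (P.body m).vars → i < P.arity m
  arityOK : ∀ m, (P.body m).ArityOK P.arity
  initOK : ∀ m, (P.body m).InitOK {x | ∃ i < P.arity m, x = Var.arg i}

/-- Effect of a simple command on the number `d` of open `lock()`s, in a block that was entered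
with `b` open `lock()`s. A `lock()` may not raise the number above `Lmax`, and an `unlock()` has
to match a `lock()` of the same block. -/
inductive LockStep (Lmax b : ℕ) : ℕ → Cmd F → ℕ → Prop
  | lock {d : ℕ} : d < Lmax → LockStep Lmax b d .lock (d + 1)
  | unlock {d : ℕ} : b ≤ d → LockStep Lmax b (d + 1) .unlock d
  | skip {d : ℕ} : LockStep Lmax b d .skip d
  | assign {d : ℕ} (x y : Var) : LockStep Lmax b d (.assign x y) d
  | load {d : ℕ} (x : Var) (π : Path F) : LockStep Lmax b d (.load x π) d
  | store {d : ℕ} (π : Path F) (x : Var) : LockStep Lmax b d (.store π x) d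
  | alloc {d : ℕ} (x : Var) : LockStep Lmax b d (.alloc x) d

/-- `Locking P Lmax b C d`: the initial part `C` of a block that is entered with `b` open
`lock()`s leaves `d` of them open; inside `C`, all branches, loop bodies and bodies of called
methods are blocks with balanced locking, and the nesting never exceeds `Lmax`. -/
inductive Locking (P : MethodTable M F) (Lmax : ℕ) : ℕ → CStmt M F → ℕ → Prop
  | cmd {b d : ℕ} {c : Cmd F} : LockStep Lmax b b c d → Locking P Lmax b (.cmd c) d
  | seq {b d d' : ℕ} {C : CStmt M F} {c : Cmd F} :
      Locking P Lmax b C d → LockStep Lmax b d c d' → Locking P Lmax b (.seq C c) d'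
  | ite {b d : ℕ} {C C₁ C₂ : CStmt M F} :
      Locking P Lmax b C d → Locking P Lmax d C₁ d → Locking P Lmax d C₂ d →
      Locking P Lmax b (.ite C C₁ C₂) d
  | loop {b d : ℕ} {C C' : CStmt M F} :
      Locking P Lmax b C d → Locking P Lmax d C' d → Locking P Lmax b (.loop C C') d
  | call {b d : ℕ} {C : CStmt M F} {m : M} {es : List (Exp F)} :
      Locking P Lmax b C d → Locking P Lmax d (P.body m) d →
      Locking P Lmax b (.call C m es) d

/-- Balanced locking, with nesting depth at most `Lmax`. -/
def BalancedLocking (P : MethodTable M F) (Lmax : ℕ) (C : CStmt M F) : Prop :=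
  Locking P Lmax 0 C 0

end

/-! ## Single-threaded semantics -/

/-- Object locations. -/
abbrev Loc := ℕ

/-- The location that is never allocated. -/
def nil : Loc := 0

/-- Stores of local variables. -/
abbrev Stack := Var → Loc

/-- Addresses. -/
abbrev Addr (F : Type*) := Loc × F

/-- Heaps: finite partial maps from addresses to locations, undefined at `nil`. -/
structure Heap (F : Type*) where
  get : Addr F → Option Loc
  finite : {α | get α ≠ none}.Finite
  get_nil : ∀ f, get (nil, f) = none

/-- A call-stack (current frame first), a heap and a lock context. -/
structure Config (F : Type*) where
  stk : List Stack
  heap : Heap F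
  locks : ℕ

/-- A program state: a command and the configuration that its execution has produced. -/
structure PState (F : Type*) where
  cmd : RCmd F
  cfg : Config F

section
variable {M F : Type*}

/-- The locations allocated in a heap. -/
def Heap.locs (h : Heap F) : Set Loc :=
  {ℓ | ∃ f, h.get (ℓ, f) ≠ none}

/-- The address of a path. -/
def lval (s : Stack) (h : Heap F) : Path F → Option (Addr F)
  | .base x f => some (s x, f)
  | .field π f => ((lval s h π).bind h.get).map (fun ℓ => (ℓ, f))

/-- The value of an expression. -/
def eval (s : Stack) (h : Heap F) : Exp F → Option Loc
  | .var x => some (s x)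
  | .path π => (lval s h π).bind h.get

/-- The frame of a call with the given values of the formals; everything else is `nil`. -/
def frame (ls : List Loc) : Stack
  | .arg i => ls.getD i nil
  | .loc _ => nil

/-- Capped addition of lock contexts. -/
def addLock (Lmax L L' : ℕ) : ℕ := min (L + L') Lmax

/-- Execution of a simple command other than `skip`. -/
inductive Step (Lmax : ℕ) : RCmd F → Config F → Config F → Prop
  | assign {x y : Var} {s : Stack} {S : List Stack} {h : Heap F} {L : ℕ} :
      Step Lmax (.base (.assign x y)) ⟨s :: S, h, L⟩ ⟨Function.update s x (s y) :: S, h, L⟩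
  | load {x : Var} {π : Path F} {s : Stack} {S : List Stack} {h : Heap F} {L : ℕ}
      {α : Addr F} {ℓ : Loc} :
      lval s h π = some α → h.get α = some ℓ →
      Step Lmax (.base (.load x π)) ⟨s :: S, h, L⟩ ⟨Function.update s x ℓ :: S, h, L⟩
  | store {π : Path F} {x : Var} {s : Stack} {S : List Stack} {h h' : Heap F} {L : ℕ}
      {α : Addr F} :
      lval s h π = some α → h.get α ≠ none →
      h'.get α = some (s x) → (∀ β, β ≠ α → h'.get β = h.get β) →
      Step Lmax (.base (.store π x)) ⟨s :: S, h, L⟩ ⟨s :: S, h', L⟩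
  | alloc {x : Var} {s : Stack} {S : List Stack} {h h' : Heap F} {L : ℕ} {ℓ : Loc} :
      ℓ ≠ nil → ℓ ∉ h.locs →
      (∀ f, h'.get (ℓ, f) = some ℓ) → (∀ β, β.1 ≠ ℓ → h'.get β = h.get β) →
      Step Lmax (.base (.alloc x)) ⟨s :: S, h, L⟩ ⟨Function.update s x ℓ :: S, h', L⟩
  | lock {S : List Stack} {h : Heap F} {L : ℕ} :
      Step Lmax (.base .lock) ⟨S, h, L⟩ ⟨S, h, addLock Lmax L 1⟩
  | unlock {S : List Stack} {h : Heap F} {L : ℕ} :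
      0 < L → Step Lmax (.base .unlock) ⟨S, h, L⟩ ⟨S, h, L - 1⟩
  | push {es : List (Exp F)} {ls : List Loc} {s : Stack} {S : List Stack} {h : Heap F} {L : ℕ} :
      List.Forall₂ (fun e ℓ => eval s h e = some ℓ) es ls →
      Step Lmax (.push es) ⟨s :: S, h, L⟩ ⟨frame ls :: s :: S, h, L⟩
  | pop {s : Stack} {S : List Stack} {h : Heap F} {L : ℕ} :
      Step Lmax .pop ⟨s :: S, h, L⟩ ⟨S, h, L⟩

/-- The configuration reached by a trace that starts in `σ`. -/
def lastCfg (τ : List (PState F)) (σ : Config F) : Config F :=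
  (τ.getLast?.map PState.cfg).getD σ

/-- Traces of a simple command: the empty trace for `skip`, one state for any other. -/
inductive CmdTrace (Lmax : ℕ) : RCmd F → Config F → List (PState F) → Prop
  | skip {σ : Config F} : CmdTrace Lmax (.base .skip) σ []
  | step {c : RCmd F} {σ σ' : Config F} : Step Lmax c σ σ' → CmdTrace Lmax c σ [⟨c, σ'⟩]

/-- The trace-collecting semantics: `Trace P Lmax C σ τ` says that `τ` is a trace of (a complete
execution of) `C` from `σ`. The two rules for loops generate the least fixed point. -/
inductive Trace (P : MethodTable M F) (Lmax : ℕ) :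
    CStmt M F → Config F → List (PState F) → Prop
  | cmd {c : Cmd F} {σ : Config F} {τ : List (PState F)} :
      CmdTrace Lmax (.base c) σ τ → Trace P Lmax (.cmd c) σ τ
  | seq {C : CStmt M F} {c : Cmd F} {σ : Config F} {τ τ' : List (PState F)} :
      Trace P Lmax C σ τ → CmdTrace Lmax (.base c) (lastCfg τ σ) τ' →
      Trace P Lmax (.seq C c) σ (τ ++ τ')
  | iteLeft {C C₁ C₂ : CStmt M F} {σ : Config F} {τ τ' : List (PState F)} :
      Trace P Lmax C σ τ → Trace P Lmax C₁ (lastCfg τ σ) τ' →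
      Trace P Lmax (.ite C C₁ C₂) σ (τ ++ τ')
  | iteRight {C C₁ C₂ : CStmt M F} {σ : Config F} {τ τ' : List (PState F)} :
      Trace P Lmax C σ τ → Trace P Lmax C₂ (lastCfg τ σ) τ' →
      Trace P Lmax (.ite C C₁ C₂) σ (τ ++ τ')
  | loopExit {C C' : CStmt M F} {σ : Config F} {τ : List (PState F)} :
      Trace P Lmax C σ τ → Trace P Lmax (.loop C C') σ τ
  | loopIter {C C' : CStmt M F} {σ : Config F} {τ τ' : List (PState F)} :
      Trace P Lmax (.loop C C') σ τ → Trace P Lmax C' (lastCfg τ σ) τ' →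
      Trace P Lmax (.loop C C') σ (τ ++ τ')
  | call {C : CStmt M F} {m : M} {es : List (Exp F)} {σ σ₁ σ₂ : Config F}
      {τ τ' : List (PState F)} :
      Trace P Lmax C σ τ → Step Lmax (.push es) (lastCfg τ σ) σ₁ →
      Trace P Lmax (P.body m) σ₁ τ' → Step Lmax .pop (lastCfg τ' σ₁) σ₂ →
      Trace P Lmax (.call C m es) σ (τ ++ [⟨.push es, σ₁⟩] ++ τ' ++ [⟨.pop, σ₂⟩])

end

/-! ## Concurrent semantics and data races -/

/-- Two call-stacks, a shared heap, and two lock contexts. -/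
structure Config₂ (F : Type*) where
  stk₁ : List Stack
  stk₂ : List Stack
  heap : Heap F
  locks₁ : ℕ
  locks₂ : ℕ

/-- A command of one of the two threads: `c ∥ ε` or `ε ∥ c`. -/
inductive Cmd₂ (F : Type*) where
  | left (c : RCmd F)
  | right (c : RCmd F)

/-- A two-threaded program state. In concurrent traces, the configuration is the one in which
the command is about to be executed. -/
structure PState₂ (F : Type*) where
  cmd : Cmd₂ F
  cfg : Config₂ F

section
variable {M F : Type*}

/-- Interleavings of (the commands of) two single-threaded traces, executed from a two-threaded
configuration. They are closed under prefixes, and a thread may only step if the other does not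
hold the lock or if the step does not involve holding it. -/
inductive Interleave (Lmax : ℕ) :
    List (PState F) → List (PState F) → Config₂ F → List (PState₂ F) → Prop
  | done {τ₁ τ₂ : List (PState F)} {κ : Config₂ F} : Interleave Lmax τ₁ τ₂ κ []
  | nextLeft {ς : PState F} {τ₁ τ₂ : List (PState F)} {κ : Config₂ F} :
      Interleave Lmax (ς :: τ₁) τ₂ κ [⟨.left ς.cmd, κ⟩]
  | nextRight {ς : PState F} {τ₁ τ₂ : List (PState F)} {κ : Config₂ F} :
      Interleave Lmax τ₁ (ς :: τ₂) κ [⟨.right ς.cmd, κ⟩]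
  | stepLeft {ς : PState F} {τ₁ τ₂ : List (PState F)} {τ : List (PState₂ F)}
      {S₁ S₂ S₁' : List Stack} {h h' : Heap F} {L₁ L₂ L₁' : ℕ} :
      Step Lmax ς.cmd ⟨S₁, h, L₁⟩ ⟨S₁', h', L₁'⟩ →
      (L₂ = 0 ∨ (L₁ = 0 ∧ L₁' = 0)) →
      Interleave Lmax τ₁ τ₂ ⟨S₁', S₂, h', L₁', L₂⟩ τ →
      Interleave Lmax (ς :: τ₁) τ₂ ⟨S₁, S₂, h, L₁, L₂⟩
        (⟨.left ς.cmd, ⟨S₁, S₂, h, L₁, L₂⟩⟩ :: τ)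
  | stepRight {ς : PState F} {τ₁ τ₂ : List (PState F)} {τ : List (PState₂ F)}
      {S₁ S₂ S₂' : List Stack} {h h' : Heap F} {L₁ L₂ L₂' : ℕ} :
      Step Lmax ς.cmd ⟨S₂, h, L₂⟩ ⟨S₂', h', L₂'⟩ →
      (L₁ = 0 ∨ (L₂ = 0 ∧ L₂' = 0)) →
      Interleave Lmax τ₁ τ₂ ⟨S₁, S₂', h', L₁, L₂'⟩ τ →
      Interleave Lmax τ₁ (ς :: τ₂) ⟨S₁, S₂, h, L₁, L₂⟩
        (⟨.right ς.cmd, ⟨S₁, S₂, h, L₁, L₂⟩⟩ :: τ)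

/-- The concurrent trace-collecting semantics of `C₁ ∥ C₂`. -/
def ConcTrace (P : MethodTable M F) (Lmax : ℕ) (C₁ C₂ : CStmt M F) (κ : Config₂ F)
    (τ : List (PState₂ F)) : Prop :=
  ∃ τ₁ τ₂, Trace P Lmax C₁ ⟨κ.stk₁, κ.heap, κ.locks₁⟩ τ₁ ∧
    Trace P Lmax C₂ ⟨κ.stk₂, κ.heap, κ.locks₂⟩ τ₂ ∧ Interleave Lmax τ₁ τ₂ κ τ

/-- `c` is a store to `π`. -/
def StoresTo (c : RCmd F) (π : Path F) : Prop := ∃ x, c = .base (.store π x)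

/-- `c` is a load from `π`. -/
def LoadsFrom (c : RCmd F) (π : Path F) : Prop := ∃ x, c = .base (.load x π)

/-- The concurrent trace `τ` of `C₁ ∥ C₂` from `κ₀` races: it leads to a configuration `κ` in
which both threads can go on with an access, `c₁` to `π₁` and `c₂` to `π₂`, at least one of them
a store, and the two paths have the same address in `κ`. -/
def Races (P : MethodTable M F) (Lmax : ℕ) (C₁ C₂ : CStmt M F) (κ₀ : Config₂ F)
    (τ : List (PState₂ F)) : Prop :=
  ConcTrace P Lmax C₁ C₂ κ₀ τ ∧
  ∃ (κ : Config₂ F) (s₁ s₂ : Stack) (S₁ S₂ : List Stack) (π₁ π₂ : Path F) (c₁ c₂ : RCmd F)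
    (α : Addr F),
    κ.stk₁ = s₁ :: S₁ ∧ κ.stk₂ = s₂ :: S₂ ∧
    lval s₁ κ.heap π₁ = some α ∧ lval s₂ κ.heap π₂ = some α ∧
    ConcTrace P Lmax C₁ C₂ κ₀ (τ ++ [⟨.left c₁, κ⟩]) ∧
    ConcTrace P Lmax C₁ C₂ κ₀ (τ ++ [⟨.right c₂, κ⟩]) ∧
    ((StoresTo c₁ π₁ ∧ StoresTo c₂ π₂) ∨ (StoresTo c₁ π₁ ∧ LoadsFrom c₂ π₂) ∨
      (LoadsFrom c₁ π₁ ∧ StoresTo c₂ π₂))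

/-- Well-behaved two-threaded configurations: no variable and no cell dangles. -/
def WellBehaved (κ : Config₂ F) : Prop :=
  (∀ s ∈ κ.stk₁ ++ κ.stk₂, ∀ x, s x ∈ κ.heap.locs) ∧
  (∀ α ℓ, κ.heap.get α = some ℓ → ℓ ∈ κ.heap.locs)

end

/-! ## The analysis -/

/-- Recorded accesses: commands `x := π` and `π := x`. -/
inductive Access (F : Type*) where
  | load (x : Var) (π : Path F)
  | store (π : Path F) (x : Var)

/-- Abstract states: wobbly expressions, lock context, accesses with their lock contexts. -/
structure AState (F : Type*) where
  W : Set (Exp F)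
  L : ℕ
  A : Set (Access F × ℕ)

section
variable {M F : Type*}

/-- The path component of an access. -/
def Access.path : Access F → Path F
  | .load _ π => π
  | .store π _ => π

/-- The access is a write. -/
def Access.IsStore : Access F → Prop
  | .load _ _ => False
  | .store _ _ => True

/-- Substitution in the path component of an access. -/
def Access.subst (θ : Var → Option (Exp F)) : Access F → Option (Access F)
  | .load x π => (π.subst θ).map (fun ρ => .load x ρ)
  | .store π x => (π.subst θ).map (fun ρ => .store ρ x)

/-- The filter that selects the expressions rooted at formals. -/
def fml (E : Set (Exp F)) : Set (Exp F) := {e ∈ E | e.root.IsFormal}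

/-- The filter that selects the accesses to paths rooted at formals. -/
def fmlA (A : Set (Access F × ℕ)) : Set (Access F × ℕ) := {q ∈ A | q.1.path.root.IsFormal}

/-- The least abstract state. -/
def AState.bot : AState F := ⟨∅, 0, ∅⟩

/-- The join of abstract states. -/
def AState.join (D₁ D₂ : AState F) : AState F := ⟨D₁.W ∪ D₂.W, max D₁.L D₂.L, D₁.A ∪ D₂.A⟩

/-- Wobbly expressions after a simple command. -/
def Cmd.wobbly (W : Set (Exp F)) : Cmd F → Set (Exp F)
  | .assign x y => W ∪ fml {.var x, .var y}
  | .load x π => W ∪ fml {.var x, .path π}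
  | .store π x => W ∪ fml {.var x, .path π}
  | .alloc x => W ∪ fml {.var x}
  | .skip | .lock | .unlock => W

/-- The abstract lock context after a simple command. -/
def Cmd.locking (Lmax L : ℕ) : Cmd F → ℕ
  | .lock => addLock Lmax L 1
  | .unlock => L - 1
  | .skip | .assign _ _ | .load _ _ | .store _ _ | .alloc _ => L

/-- The recorded accesses after a simple command. -/
def Cmd.accs (A : Set (Access F × ℕ)) (L : ℕ) : Cmd F → Set (Access F × ℕ)
  | .load x π => A ∪ fmlA {(.load x π, L)}
  | .store π x => A ∪ fmlA {(.store π x, L)}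
  | .skip | .assign _ _ | .alloc _ | .lock | .unlock => A

/-- Abstract semantics of simple commands. -/
def Cmd.abs (Lmax : ℕ) (c : Cmd F) (D : AState F) : AState F :=
  ⟨c.wobbly D.W, c.locking Lmax D.L, c.accs D.A D.L⟩

/-- The actuals that are prefixes of an actual at another position. -/
def overlaps (es : List (Exp F)) : Set (Exp F) :=
  {e | ∃ (i j : ℕ) (e' : Exp F), i ≠ j ∧ es[i]? = some e ∧ es[j]? = some e' ∧ e.Prefix e'}

/-- Abstract semantics of a call with actuals `es` of a method with summary `D'`. -/
def absCall (Lmax : ℕ) (es : List (Exp F)) (D' D : AState F) : AState F where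
  W := D.W ∪ fml (overlaps es ∪ {e | ∃ e' ∈ D'.W, e'.subst (actuals es) = some e})
  L := addLock Lmax D.L D'.L
  A := D.A ∪ fmlA {q | ∃ q' ∈ D'.A, q'.1.subst (actuals es) = some q.1 ∧
    q.2 = addLock Lmax D.L q'.2}

/-- Abstract semantics of compound programs, relative to a table of method summaries. -/
def CStmt.absWith (Lmax : ℕ) (summary : M → AState F) : CStmt M F → AState F → AState F
  | .cmd c, D => c.abs Lmax D
  | .seq C c, D => c.abs Lmax (C.absWith Lmax summary D)
  | .ite C C₁ C₂, D =>
      (C₁.absWith Lmax summary (C.absWith Lmax summary D)).join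
        (C₂.absWith Lmax summary (C.absWith Lmax summary D))
  | .loop C C', D =>
      (C.absWith Lmax summary D).join (C'.absWith Lmax summary (C.absWith Lmax summary D))
  | .call C m es, D => absCall Lmax es (summary m) (C.absWith Lmax summary D)

open Classical in
/-- The summary of a method, by recursion along the call relation. -/
noncomputable def MethodTable.summary (P : MethodTable M F) (Lmax : ℕ) : M → AState F :=
  P.acyclic.fix fun m rec =>
    (P.body m).absWith Lmax
      (fun m' => if h : m' ∈ (P.body m).calls then rec m' h else AState.bot) AState.bot

/-- The abstract semantics of compound programs. -/
noncomputable def MethodTable.analyse (P : MethodTable M F) (Lmax : ℕ) (C : CStmt M F) :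
    AState F → AState F :=
  C.absWith Lmax (P.summary Lmax)

theorem CStmt.absWith_congr (Lmax : ℕ) (Φ Ψ : M → AState F) (C : CStmt M F) :
    (∀ m ∈ C.calls, Φ m = Ψ m) → C.absWith Lmax Φ = C.absWith Lmax Ψ := by
  induction C with
  | cmd c => intro _; rfl
  | seq C c ih => intro h; funext D; simp only [CStmt.absWith, ih h]
  | ite C C₁ C₂ ih ih₁ ih₂ =>
    intro h
    funext D
    simp only [CStmt.absWith, ih fun m hm => h m (Or.inl (Or.inl hm)),
      ih₁ fun m hm => h m (Or.inl (Or.inr hm)), ih₂ fun m hm => h m (Or.inr hm)]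
  | loop C C' ih ih' =>
    intro h
    funext D
    simp only [CStmt.absWith, ih fun m hm => h m (Or.inl hm), ih' fun m hm => h m (Or.inr hm)]
  | call C m es ih =>
    intro h
    funext D
    simp only [CStmt.absWith, ih fun m hm => h m (Or.inl hm), h m (Or.inr rfl)]

/-- The summary of a method is the abstract semantics of its body, from the least state. -/
theorem MethodTable.summary_eq (P : MethodTable M F) (Lmax : ℕ) (m : M) :
    P.summary Lmax m = P.analyse Lmax (P.body m) AState.bot := by
  unfold MethodTable.summary MethodTable.analyse
  rw [WellFounded.fix_eq]
  refine congrFun (CStmt.absWith_congr Lmax _ _ (P.body m) fun m' hm' => ?_) AState.bot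
  rw [dif_pos hm']
  rfl

end

end RacerDX

open RacerDX

namespace RacerDX

section
variable {M F : Type*}

/-! Let `fs` be the common field sequence of the two paths. The initial heap contains a chain of
objects `fs.length, …, 1`, in which location `t.length` stands for the nonempty suffix `t` of `fs`
still to be travelled. All other cells refer to a sink object `fs.length + 1`. In each thread the
root of the accessed path refers to the head of the chain and every other variable to the sink. In
this state an expression denotes a chain location exactly if it is a proper prefix of the accessed
path, so by hypothesis no wobbly expression does (`properPrefix_of_onChain`).

Every command that could copy or overwrite a reference to the chain marks the expressions involved
as wobbly. Since wobbly sets only grow, the final set controls the whole execution: the chain stays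
intact, no reference to it is gained or lost, and nothing gets stuck (`Cmd.exec_word`, `Word.exec`).
Passing arguments respects positions on the chain, because substituting an actual for a formal
concatenates field sequences (`along_frame_iff`). Hence a recorded access, even deep inside calls,
is reached by some execution, and its path then leads along the whole chain to location `1`
(`Locking.reaches`, `ChainHeap.lval_eq`). One pass through a loop suffices, since the analysis makes
only one. Balanced locking makes the abstract lock contexts exact (`Locking.analyse_L`).

From `L₁ + L₂ ≤ 1`, one of the accesses happens without the lock. That thread runs first and stops
just before its access. The heap it leaves still carries the chain, and the other frame is
untouched, so the second thread can run to its access as well. Both are then about to access the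
last field of `fs` at location `1`. -/

/-! ## Words of commands and their execution -/

/-- The commands that a simple command contributes to an execution. -/
def Cmd.word : Cmd F → List (RCmd F)
  | .skip => []
  | .assign x y => [.base (.assign x y)]
  | .load x π => [.base (.load x π)]
  | .store π x => [.base (.store π x)]
  | .alloc x => [.base (.alloc x)]
  | .lock => [.base .lock]
  | .unlock => [.base .unlock]

/-- Command sequences of the complete executions of a program that iterate each loop at most
once. -/
inductive Word (P : MethodTable M F) : CStmt M F → List (RCmd F) → Prop
  | cmd (c : Cmd F) : Word P (.cmd c) c.word
  | seq {C : CStmt M F} {w : List (RCmd F)} (c : Cmd F) :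
      Word P C w → Word P (.seq C c) (w ++ c.word)
  | iteLeft {C C₁ : CStmt M F} {w w' : List (RCmd F)} (C₂ : CStmt M F) :
      Word P C w → Word P C₁ w' → Word P (.ite C C₁ C₂) (w ++ w')
  | iteRight {C C₂ : CStmt M F} {w w' : List (RCmd F)} (C₁ : CStmt M F) :
      Word P C w → Word P C₂ w' → Word P (.ite C C₁ C₂) (w ++ w')
  | loopExit {C : CStmt M F} {w : List (RCmd F)} (C' : CStmt M F) :
      Word P C w → Word P (.loop C C') w
  | loopOnce {C C' : CStmt M F} {w w' : List (RCmd F)} :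
      Word P C w → Word P C' w' → Word P (.loop C C') (w ++ w')
  | call {C : CStmt M F} {m : M} {w w' : List (RCmd F)} (es : List (Exp F)) :
      Word P C w → Word P (P.body m) w' →
      Word P (.call C m es) (w ++ [.push es] ++ w' ++ [.pop])

/-- Successive execution of commands. -/
inductive Exec (Lmax : ℕ) : List (RCmd F) → Config F → Config F → Prop
  | nil {σ : Config F} : Exec Lmax [] σ σ
  | cons {c : RCmd F} {w : List (RCmd F)} {σ σ' σ'' : Config F} :
      Step Lmax c σ σ' → Exec Lmax w σ' σ'' → Exec Lmax (c :: w) σ σ''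

theorem Exec.single {Lmax : ℕ} {c : RCmd F} {σ σ' : Config F} (h : Step Lmax c σ σ') :
    Exec Lmax [c] σ σ' := .cons h .nil

theorem exec_append {Lmax : ℕ} {w w' : List (RCmd F)} {σ σ'' : Config F} :
    Exec Lmax (w ++ w') σ σ'' ↔ ∃ σ', Exec Lmax w σ σ' ∧ Exec Lmax w' σ' σ'' := by
  induction w generalizing σ with
  | nil =>
    constructor
    · exact fun h => ⟨σ, .nil, h⟩
    · rintro ⟨_, ⟨⟩, h⟩; exact h
  | cons c w ih =>
    constructor
    · rintro (_ | ⟨h₁, h₂⟩)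
      obtain ⟨σ', h, h'⟩ := ih.1 h₂
      exact ⟨σ', .cons h₁ h, h'⟩
    · rintro ⟨σ', _ | ⟨h₁, h₂⟩, h'⟩
      exact .cons h₁ (ih.2 ⟨σ', h₂, h'⟩)

theorem exec_singleton {Lmax : ℕ} {c : RCmd F} {σ σ' : Config F} :
    Exec Lmax [c] σ σ' ↔ Step Lmax c σ σ' :=
  ⟨by rintro (_ | ⟨h, ⟨⟩⟩); exact h, .single⟩

theorem lastCfg_append (τ τ' : List (PState F)) (σ : Config F) :
    lastCfg (τ ++ τ') σ = lastCfg τ' (lastCfg τ σ) := by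
  unfold lastCfg
  rw [List.getLast?_append]
  cases τ'.getLast? <;> simp

theorem Cmd.exists_trace {Lmax : ℕ} {c : Cmd F} {σ σ' : Config F} (h : Exec Lmax c.word σ σ') :
    ∃ τ, CmdTrace Lmax (.base c) σ τ ∧ τ.map PState.cmd = c.word ∧ lastCfg τ σ = σ' := by
  by_cases hc : c = .skip
  · subst hc
    obtain ⟨⟩ := h
    exact ⟨[], .skip, rfl, rfl⟩
  · have hw : c.word = [.base c] := by cases c <;> first | rfl | exact absurd rfl hc
    rw [hw] at h ⊢
    exact ⟨_, .step (exec_singleton.1 h), rfl, rfl⟩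

/-- Words carry no configurations, so one word can be executed both alone, as `ConcTrace` demands,
and in the heap left by the other thread. This lemma turns the execution alone into a trace. -/
theorem Word.exists_trace {P : MethodTable M F} {Lmax : ℕ} {C : CStmt M F} {w : List (RCmd F)}
    (hw : Word P C w) {σ σ' : Config F} (h : Exec Lmax w σ σ') :
    ∃ τ, Trace P Lmax C σ τ ∧ τ.map PState.cmd = w ∧ lastCfg τ σ = σ' := by
  induction hw generalizing σ σ' with
  | cmd c =>
    obtain ⟨τ, hτ, hm, hl⟩ := Cmd.exists_trace h
    exact ⟨τ, .cmd hτ, hm, hl⟩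
  | seq c _ ih =>
    obtain ⟨σ₁, h₁, h₂⟩ := exec_append.1 h
    obtain ⟨τ, hτ, rfl, rfl⟩ := ih h₁
    obtain ⟨τ', hτ', hm, rfl⟩ := Cmd.exists_trace h₂
    exact ⟨_, .seq hτ hτ', by simp [hm], lastCfg_append _ _ _⟩
  | iteLeft _ _ _ ih ih' =>
    obtain ⟨σ₁, h₁, h₂⟩ := exec_append.1 h
    obtain ⟨τ, hτ, rfl, rfl⟩ := ih h₁
    obtain ⟨τ', hτ', rfl, rfl⟩ := ih' h₂
    exact ⟨_, .iteLeft hτ hτ', by simp, lastCfg_append _ _ _⟩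
  | iteRight _ _ _ ih ih' =>
    obtain ⟨σ₁, h₁, h₂⟩ := exec_append.1 h
    obtain ⟨τ, hτ, rfl, rfl⟩ := ih h₁
    obtain ⟨τ', hτ', rfl, rfl⟩ := ih' h₂
    exact ⟨_, .iteRight hτ hτ', by simp, lastCfg_append _ _ _⟩
  | loopExit _ _ ih =>
    obtain ⟨τ, hτ, hm, hl⟩ := ih h
    exact ⟨τ, .loopExit hτ, hm, hl⟩
  | loopOnce _ _ ih ih' =>
    obtain ⟨σ₁, h₁, h₂⟩ := exec_append.1 h
    obtain ⟨τ, hτ, rfl, rfl⟩ := ih h₁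
    obtain ⟨τ', hτ', rfl, rfl⟩ := ih' h₂
    exact ⟨_, .loopIter (.loopExit hτ) hτ', by simp, lastCfg_append _ _ _⟩
  | call es _ _ ih ih' =>
    obtain ⟨σ₃, h₁₂₃, h₄⟩ := exec_append.1 h
    obtain ⟨σ₂, h₁₂, h₃⟩ := exec_append.1 h₁₂₃
    obtain ⟨σ₁, h₁, h₂⟩ := exec_append.1 h₁₂
    obtain ⟨τ, hτ, rfl, rfl⟩ := ih h₁
    obtain ⟨τ', hτ', rfl, rfl⟩ := ih' h₃
    refine ⟨_, .call hτ (exec_singleton.1 h₂) hτ' (exec_singleton.1 h₄), by simp, ?_⟩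
    rw [lastCfg_append]
    rfl

/-- A locking derivation already unfolds the bodies of called methods, so induction on it reaches
them, unlike induction on the syntax. -/
theorem Locking.exists_word {P : MethodTable M F} {Lmax b d : ℕ} {C : CStmt M F}
    (h : Locking P Lmax b C d) : ∃ w, Word P C w := by
  induction h with
  | cmd _ => exact ⟨_, .cmd _⟩
  | seq _ _ ih => obtain ⟨w, hw⟩ := ih; exact ⟨_, hw.seq _⟩
  | ite _ _ _ ih ih₁ _ =>
    obtain ⟨w, hw⟩ := ih
    obtain ⟨w₁, hw₁⟩ := ih₁
    exact ⟨_, hw.iteLeft _ hw₁⟩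
  | loop _ _ ih _ => obtain ⟨w, hw⟩ := ih; exact ⟨_, hw.loopExit _⟩
  | call _ _ ih ih' =>
    obtain ⟨w, hw⟩ := ih
    obtain ⟨w', hw'⟩ := ih'
    exact ⟨_, hw.call _ hw'⟩

/-! ## Expressions and substitution -/

theorem Path.fields_ne_nil (π : Path F) : π.fields ≠ [] := by
  cases π <;> simp [Path.fields]

@[simp]
theorem Exp.extend_root (e : Exp F) (f : F) : (e.extend f).root = e.root := by
  cases e <;> rfl

@[simp]
theorem Exp.extend_fields (e : Exp F) (f : F) : (e.extend f).fields = e.fields ++ [f] := by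
  cases e <;> rfl

/-- Positions on the chain depend only on root and field sequence, so substitution matters only as
concatenation. -/
theorem Path.subst_eq_some {θ : Var → Option (Exp F)} {π ρ : Path F} (h : π.subst θ = some ρ) :
    ∃ a, θ π.root = some a ∧ ρ.root = a.root ∧ ρ.fields = a.fields ++ π.fields := by
  induction π generalizing ρ with
  | base x f =>
    obtain ⟨a, ha, rfl⟩ := Option.map_eq_some_iff.1 h
    exact ⟨a, ha, by simp, by simp [Path.fields]⟩
  | field π f ih =>
    obtain ⟨ρ', hρ', rfl⟩ := Option.map_eq_some_iff.1 h
    obtain ⟨a, ha, hr, hf⟩ := ih hρ'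
    exact ⟨a, ha, hr, by simp [Path.fields, hf]⟩

theorem Exp.subst_eq_some {θ : Var → Option (Exp F)} {e e' : Exp F} (h : e.subst θ = some e') :
    ∃ a, θ e.root = some a ∧ e'.root = a.root ∧ e'.fields = a.fields ++ e.fields := by
  cases e with
  | var x => exact ⟨e', h, rfl, by simp [Exp.fields]⟩
  | path π =>
    obtain ⟨ρ, hρ, rfl⟩ := Option.map_eq_some_iff.1 h
    exact Path.subst_eq_some hρ

theorem Path.exists_subst {θ : Var → Option (Exp F)} {π : Path F} {a : Exp F}
    (h : θ π.root = some a) : ∃ ρ, π.subst θ = some ρ := by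
  induction π with
  | base x f => exact ⟨a.extend f, Option.map_eq_some_iff.2 ⟨a, h, rfl⟩⟩
  | field π f ih =>
    obtain ⟨ρ, hρ⟩ := ih h
    exact ⟨_, Option.map_eq_some_iff.2 ⟨ρ, hρ, rfl⟩⟩

theorem Exp.exists_subst {θ : Var → Option (Exp F)} {e a : Exp F}
    (h : θ e.root = some a) : ∃ e', e.subst θ = some e' := by
  cases e with
  | var x => exact ⟨a, h⟩
  | path π =>
    obtain ⟨ρ, hρ⟩ := Path.exists_subst h
    exact ⟨_, Option.map_eq_some_iff.2 ⟨ρ, hρ, rfl⟩⟩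

theorem Access.path_subst {θ : Var → Option (Exp F)} {c c' : Access F}
    (h : c.subst θ = some c') : c.path.subst θ = some c'.path ∧ (c.IsStore ↔ c'.IsStore) := by
  cases c <;> obtain ⟨ρ, hρ, rfl⟩ := Option.map_eq_some_iff.1 h <;> exact ⟨hρ, Iff.rfl⟩

/-! ## Chains of locations -/

/-- The chain along `fs` consists of the locations `1, …, fs.length`: the nonempty suffixes of
`fs`, each represented by its length. The heap links each of them, by its first field, to the
next, and holds no other references to them. -/
def ChainHeap (fs : List F) (h : Heap F) : Prop :=
  ∀ t, t ≠ [] → t <:+ fs → ∀ α,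
    h.get α = some t.length ↔ ∃ f, f :: t <:+ fs ∧ α = (t.length + 1, f)

/-- The root of `e` refers to the location of the chain from which the fields of `e` lead to the
suffix `t`. -/
def Along (fs : List F) (s : Stack) (e : Exp F) (t : List F) : Prop :=
  e.fields ++ t <:+ fs ∧ s e.root = (e.fields ++ t).length

/-- The expression denotes a location of the chain. -/
def OnChain (fs : List F) (s : Stack) (e : Exp F) : Prop :=
  ∃ t, t ≠ [] ∧ Along fs s e t

/-- The two stacks refer to the same locations of the chain. -/
def SameChain (fs : List F) (s s' : Stack) : Prop :=
  ∀ x ℓ, 0 < ℓ → ℓ ≤ fs.length → (s' x = ℓ ↔ s x = ℓ)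

/-- With `suffix_eq_of_length`, this identifies chain locations with the numbers from `1` to
`fs.length`. The value `nil = 0` is thereby off the chain. -/
theorem exists_suffix_length {fs : List F} {ℓ : ℕ} (h0 : 0 < ℓ) (h : ℓ ≤ fs.length) :
    ∃ t, t ≠ [] ∧ t <:+ fs ∧ t.length = ℓ := by
  refine ⟨fs.drop (fs.length - ℓ), ?_, List.drop_suffix _ _, ?_⟩
  · intro h'
    have := congrArg List.length h'
    simp at this
    omega
  · simp; omega

theorem suffix_eq_of_length {fs t u : List F} (ht : t <:+ fs) (hu : u <:+ fs)
    (h : t.length = u.length) : t = u :=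
  (List.suffix_of_suffix_length_le ht hu h.le).eq_of_length h

theorem SameChain.refl (fs : List F) (s : Stack) : SameChain fs s s := fun _ _ _ _ => Iff.rfl

theorem SameChain.trans {fs : List F} {s s' s'' : Stack} (h : SameChain fs s s')
    (h' : SameChain fs s' s'') : SameChain fs s s'' :=
  fun x ℓ h0 hl => (h' x ℓ h0 hl).trans (h x ℓ h0 hl)

/-- `Along` consults the stack only at the root, and demands there the length of a nonempty suffix
of `fs`, which is a chain location. -/
theorem SameChain.along {fs : List F} {s s' : Stack} (h : SameChain fs s s') {e : Exp F}
    {t : List F} (ht : e.fields ++ t ≠ []) : Along fs s' e t ↔ Along fs s e t := by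
  unfold Along
  refine and_congr_right fun hs => h _ _ (List.length_pos_iff.2 ht) hs.length_le

theorem SameChain.onChain {fs : List F} {s s' : Stack} (h : SameChain fs s s') {e : Exp F} :
    OnChain fs s' e ↔ OnChain fs s e :=
  exists_congr fun _ => and_congr_right fun ht => h.along (by simp [ht])

/-- The old value of `x` is off the chain, so no reference is lost; the new one is too, so none is
gained. -/
theorem SameChain.update {fs : List F} {s : Stack} {x : Var} {ℓ : Loc}
    (hx : ¬ OnChain fs s (.var x)) (hl : ¬ (0 < ℓ ∧ ℓ ≤ fs.length)) :
    SameChain fs s (Function.update s x ℓ) := by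
  intro y k h0 hk
  by_cases hy : y = x
  · subst hy
    rw [Function.update_self]
    refine iff_of_false (by rintro rfl; exact hl ⟨h0, hk⟩) fun hs => hx ?_
    obtain ⟨t, ht, hts, rfl⟩ := exists_suffix_length h0 hk
    exact ⟨t, ht, hts, hs⟩
  · rw [Function.update_of_ne hy]

theorem not_mem_chain {fs : List F} {s : Stack} {x : Var} (hx : ¬ OnChain fs s (.var x)) :
    ¬ (0 < s x ∧ s x ≤ fs.length) := by
  rintro ⟨h0, hk⟩
  obtain ⟨t, ht, hts, hl⟩ := exists_suffix_length h0 hk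
  exact hx ⟨t, ht, hts, hl.symm⟩

/-- With a chain in the heap, the values on the chain are those reached along it. -/
theorem ChainHeap.eval_eq_iff {fs : List F} {h : Heap F} (hh : ChainHeap fs h) {s : Stack}
    {e : Exp F} {t : List F} (ht : t ≠ []) (hts : t <:+ fs) :
    eval s h e = some t.length ↔ Along fs s e t := by
  -- The suffix varies in the induction: removing the last field of the path puts it in front of
  -- `t`. From value to position, the point is that `ChainHeap` is an equivalence: location
  -- `t.length` is referred to only by its link, so the last field of the path must be that of the
  -- link.
  have key : ∀ (π : Path F) (t : List F), t ≠ [] → t <:+ fs →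
      (eval s h (.path π) = some t.length ↔ Along fs s (.path π) t) := by
    intro π
    induction π with
    | base x f =>
      intro t ht hts
      simp only [eval, lval, Option.bind_some, hh t ht hts, Along, Exp.fields, Path.fields,
        Exp.root, Path.root, List.cons_append, List.nil_append, List.length_cons]
      constructor
      · rintro ⟨g, hg, he⟩
        obtain ⟨h₁, rfl⟩ := Prod.mk.inj he
        exact ⟨hg, h₁⟩
      · rintro ⟨hg, he⟩
        exact ⟨f, hg, by rw [he]⟩
    | field π f ih =>
      intro t ht hts
      have h1 : Along fs s (.path (.field π f)) t ↔ Along fs s (.path π) (f :: t) := by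
        simp [Along, Exp.fields, Path.fields, Exp.root, Path.root]
      rw [h1]
      constructor
      · intro he
        obtain ⟨α, hα, hv⟩ := Option.bind_eq_some_iff.1 he
        obtain ⟨ℓ, hl, rfl⟩ := Option.map_eq_some_iff.1 hα
        obtain ⟨g, hg, he'⟩ := (hh t ht hts _).1 hv
        obtain ⟨rfl, rfl⟩ := Prod.mk.inj he'
        exact (ih (f :: t) (by simp) hg).1 hl
      · intro ha
        have hs : f :: t <:+ fs := (List.suffix_append _ _).trans ha.1
        have := (ih (f :: t) (by simp) hs).2 ha
        refine Option.bind_eq_some_iff.2 ⟨(t.length + 1, f),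
          Option.map_eq_some_iff.2 ⟨t.length + 1, this, rfl⟩, ?_⟩
        exact (hh t ht hts _).2 ⟨f, hs, rfl⟩
  cases e with
  | var x => simp [eval, Along, Exp.fields, Exp.root, hts]
  | path π => exact key π t ht hts

theorem ChainHeap.onChain_of_eval {fs : List F} {h : Heap F} (hh : ChainHeap fs h) {s : Stack}
    {e : Exp F} {ℓ : Loc} (he : eval s h e = some ℓ) (h0 : 0 < ℓ) (hl : ℓ ≤ fs.length) :
    OnChain fs s e := by
  obtain ⟨t, ht, hts, rfl⟩ := exists_suffix_length h0 hl
  exact ⟨t, ht, (hh.eval_eq_iff ht hts).1 he⟩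

/-- A path that leads along the whole chain has the address of the last field of its last
location. -/
theorem ChainHeap.lval_eq {fs : List F} {h : Heap F} (hh : ChainHeap fs h) {s : Stack}
    {π : Path F} (hπ : Along fs s (.path π) []) : ∃ f, [f] <:+ fs ∧ lval s h π = some (1, f) := by
  cases π with
  | base x f =>
    refine ⟨f, by simpa [Exp.fields, Path.fields] using hπ.1, ?_⟩
    have := hπ.2
    simp only [Exp.root, Path.root, Exp.fields, Path.fields] at this
    simp [lval, this]
  | field π f =>
    have h1 : Along fs s (.path π) [f] := by
      simpa [Along, Exp.fields, Path.fields, Exp.root, Path.root] using hπ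
    have hs : [f] <:+ fs := (List.suffix_append _ _).trans h1.1
    refine ⟨f, hs, Option.map_eq_some_iff.2 ⟨1, ?_, rfl⟩⟩
    exact (hh.eval_eq_iff (by simp) hs).2 h1

/-- Passing arguments turns positions on the chain relative to the actuals into positions
relative to the formals. -/
theorem along_frame_iff {fs : List F} {h : Heap F} (hh : ChainHeap fs h) {s : Stack}
    {es : List (Exp F)} {ls : List Loc} (hes : List.Forall₂ (fun e ℓ => eval s h e = some ℓ) es ls)
    {e e' : Exp F} {t : List F} (hsub : e.subst (actuals es) = some e') (ht : e.fields ++ t ≠ []) :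
    Along fs (frame ls) e t ↔ Along fs s e' t := by
  obtain ⟨a, ha, hr, hf⟩ := Exp.subst_eq_some hsub
  rcases he : e.root with i | n
  · rw [he] at ha
    obtain ⟨hi, rfl⟩ := List.getElem?_eq_some_iff.1 (show es[i]? = some a from ha)
    have hi' : i < ls.length := hes.length_eq ▸ hi
    have hev : eval s h es[i] = some ls[i] := hes.get hi hi'
    have hfr : frame ls e.root = ls[i] := by simp [he, frame, hi']
    -- Seen from the actual, the fields of `e` belong to the suffix still to be travelled. What
    -- remains is that formal and actual have the same value.
    have h1 : Along fs s e' t ↔ Along fs s es[i] (e.fields ++ t) := by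
      simp [Along, hr, hf]
    rw [h1]
    constructor
    · rintro ⟨h2, h3⟩
      refine (hh.eval_eq_iff ht h2).1 ?_
      rw [hev, ← h3, hfr]
    · intro h2
      have hs : e.fields ++ t <:+ fs := (List.suffix_append _ _).trans h2.1
      have := (hh.eval_eq_iff ht hs).2 h2
      rw [hev] at this
      exact ⟨hs, by rw [hfr]; exact Option.some.inj this⟩
  · rw [he] at ha
    exact absurd ha (by simp [actuals])

/-! ## Safe execution -/

/-- All fields of the location are allocated. -/
def Heap.Alloc (h : Heap F) (ℓ : Loc) : Prop := ∀ f, h.get (ℓ, f) ≠ none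

/-- Nothing dangles in the heap, the variables in `I` refer to objects, and the chain along `fs` is
intact and not referred to by locals. -/
structure Sound (fs : List F) (I : Set Var) (s : Stack) (h : Heap F) : Prop where
  vals : ∀ α ℓ, h.get α = some ℓ → h.Alloc ℓ
  init : ∀ x ∈ I, h.Alloc (s x)
  chain : ChainHeap fs h
  locals : ∀ n, ¬ OnChain fs s (.var (.loc n))

theorem Sound.mono {fs : List F} {I J : Set Var} {s : Stack} {h : Heap F} (hs : Sound fs I s h)
    (hJ : J ⊆ I) : Sound fs J s h :=
  ⟨hs.vals, fun x hx => hs.init x (hJ hx), hs.chain, hs.locals⟩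

/-- This makes the filter `fml` harmless: an expression that it discards cannot denote a chain
location anyway. -/
theorem Sound.isFormal {fs : List F} {I : Set Var} {s : Stack} {h : Heap F} (hs : Sound fs I s h)
    {e : Exp F} (he : OnChain fs s e) : e.root.IsFormal := by
  rcases hr : e.root with i | n
  · trivial
  · obtain ⟨t, ht, h1, h2⟩ := he
    exact absurd ⟨e.fields ++ t, by simp [ht], h1, by rw [← hr]; exact h2⟩ (hs.locals n)

/-- `Heap.Alloc` asks for all fields of a location, and every value in the heap has it again, so
following fields never gets stuck. -/
theorem Sound.exists_eval {fs : List F} {I : Set Var} {s : Stack} {h : Heap F}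
    (hs : Sound fs I s h) {e : Exp F} (he : e.root ∈ I) :
    ∃ ℓ, eval s h e = some ℓ ∧ h.Alloc ℓ := by
  cases e with
  | var x => exact ⟨s x, rfl, hs.init x he⟩
  | path π =>
    induction π with
    | base x f =>
      obtain ⟨ℓ, hl⟩ := Option.ne_none_iff_exists'.1 (hs.init x he f)
      exact ⟨ℓ, hl, hs.vals _ _ hl⟩
    | field π f ih =>
      obtain ⟨k, hk, hka⟩ := ih he
      obtain ⟨ℓ, hl⟩ := Option.ne_none_iff_exists'.1 (hka f)
      refine ⟨ℓ, ?_, hs.vals _ _ hl⟩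
      exact Option.bind_eq_some_iff.2 ⟨(k, f), Option.map_eq_some_iff.2 ⟨k, hk, rfl⟩, hl⟩

/-- The relation between the frames and heaps before and after the execution of a block. -/
structure Preserved (fs : List F) (I : Set Var) (s : Stack) (h : Heap F) (s' : Stack)
    (h' : Heap F) : Prop where
  sound : Sound fs I s' h'
  same : SameChain fs s s'
  le : ∀ ℓ, h.Alloc ℓ → h'.Alloc ℓ

theorem Preserved.trans {fs : List F} {I J : Set Var} {s s' s'' : Stack} {h h' h'' : Heap F}
    (H : Preserved fs I s h s' h') (H' : Preserved fs J s' h' s'' h'') :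
    Preserved fs J s h s'' h'' :=
  ⟨H'.sound, H.same.trans H'.same, fun ℓ hl => H'.le ℓ (H.le ℓ hl)⟩

theorem Preserved.mono {fs : List F} {I J : Set Var} {s s' : Stack} {h h' : Heap F}
    (H : Preserved fs I s h s' h') (hJ : J ⊆ I) : Preserved fs J s h s' h' :=
  ⟨H.sound.mono hJ, H.same, H.le⟩

/-- The common part of assignment, load and allocation; only allocation changes the heap. -/
theorem Sound.update {fs : List F} {I : Set Var} {s : Stack} {h h' : Heap F} {x : Var} {ℓ : Loc}
    (hs : Sound fs I s h) (hvals : ∀ α ℓ, h'.get α = some ℓ → h'.Alloc ℓ)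
    (hchain : ChainHeap fs h') (hle : ∀ ℓ, h.Alloc ℓ → h'.Alloc ℓ) (hl : h'.Alloc ℓ)
    (hx : ¬ OnChain fs s (.var x)) (hc : ¬ (0 < ℓ ∧ ℓ ≤ fs.length)) :
    Preserved fs (I ∪ {x}) s h (Function.update s x ℓ) h' := by
  have hsame := SameChain.update hx hc
  refine ⟨⟨hvals, ?_, hchain, fun n hn => hs.locals n (hsame.onChain.1 hn)⟩, hsame, hle⟩
  intro y hy
  by_cases hyx : y = x
  · subst hyx; rwa [Function.update_self]
  · rw [Function.update_of_ne hyx]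
    exact hle _ (hs.init y (hy.resolve_right hyx))

open Classical in
/-- The heap with the cell at `α` overwritten. -/
noncomputable def Heap.write (h : Heap F) (α : Addr F) (hα : h.get α ≠ none) (ℓ : Loc) :
    Heap F where
  get β := if β = α then some ℓ else h.get β
  finite := h.finite.subset fun β hβ => by
    by_cases hb : β = α
    · rw [hb]; exact hα
    · simpa [hb] using hβ
  get_nil f := by
    rw [if_neg, h.get_nil]
    rintro rfl
    exact hα (h.get_nil f)

/-- The heap with a new object at `ℓ`. -/
def Heap.addObject [Finite F] (h : Heap F) (ℓ : Loc) (hl : ℓ ≠ nil) : Heap F where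
  get β := if β.1 = ℓ then some ℓ else h.get β
  finite := by
    refine (h.finite.union ((Set.finite_singleton ℓ).prod (Set.finite_univ (α := F)))).subset ?_
    intro β hβ
    by_cases hb : β.1 = ℓ
    · exact Or.inr ⟨hb, trivial⟩
    · exact Or.inl (by simpa [hb] using hβ)
  get_nil f := by rw [if_neg (Ne.symm hl), h.get_nil]

/-- The bound keeps new objects beyond the chain. The fields of a new object refer to the object
itself, so a number up to `fs.length` would create foreign references to the chain. -/
theorem Heap.exists_fresh (h : Heap F) (n : ℕ) : ∃ ℓ, n < ℓ ∧ ℓ ∉ h.locs := by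
  have hfin : h.locs.Finite := (h.finite.image Prod.fst).subset fun ℓ ⟨f, hf⟩ => ⟨(ℓ, f), hf, rfl⟩
  obtain ⟨ℓ, hl⟩ := (hfin.union (Set.finite_Iic n)).infinite_compl.nonempty
  simp only [Set.mem_compl_iff, Set.mem_union, Set.mem_Iic, not_or, not_le] at hl
  exact ⟨ℓ, hl.2, hl.1⟩

/-- Simple commands that do not change or copy references to the chain execute safely. -/
theorem Cmd.exec_word [Finite F] {Lmax b d d' : ℕ} {c : Cmd F} {fs : List F} {I : Set Var}
    {s : Stack} {h : Heap F} {W : Set (Exp F)} (S : List Stack) (hlock : LockStep Lmax b d c d')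
    (hu : c.uses ⊆ I) (hs : Sound fs I s h) (hW : ∀ e ∈ c.wobbly W, ¬ OnChain fs s e) :
    ∃ s' h', Exec Lmax c.word ⟨s :: S, h, d⟩ ⟨s' :: S, h', d'⟩ ∧
      Preserved fs (I ∪ c.assigned) s h s' h' := by
  have hW' : ∀ {E : Set (Exp F)}, c.wobbly W = W ∪ fml E → ∀ e ∈ E, ¬ OnChain fs s e :=
    fun hE e he ho => hW e (hE ▸ Or.inr ⟨he, hs.isFormal ho⟩) ho
  have hid : Preserved fs (I ∪ ∅) s h s h :=
    ⟨hs.mono (by simp), .refl _ _, fun _ hl => hl⟩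
  cases hlock with
  | lock hd =>
    refine ⟨s, h, .single ?_, hid⟩
    have := Step.lock (Lmax := Lmax) (S := s :: S) (h := h) (L := d)
    rwa [addLock, min_eq_left hd] at this
  | unlock _ => exact ⟨s, h, .single (.unlock (Nat.succ_pos _)), hid⟩
  | skip => exact ⟨s, h, .nil, hid⟩
  | assign x y =>
    have hx := hW' rfl (.var x) (by simp)
    have hy := hW' rfl (.var y) (by simp)
    exact ⟨_, h, .single .assign, hs.update hs.vals hs.chain (fun _ hl => hl)
      (hs.init y (hu rfl)) hx (not_mem_chain hy)⟩
  | load x π =>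
    have hx := hW' rfl (.var x) (by simp)
    have hπ := hW' rfl (.path π) (by simp)
    obtain ⟨ℓ, hev, hl⟩ := hs.exists_eval (e := .path π) (hu rfl)
    obtain ⟨α, hα, hv⟩ := Option.bind_eq_some_iff.1 hev
    exact ⟨_, h, .single (.load hα hv), hs.update hs.vals hs.chain (fun _ hl => hl) hl hx
      fun hc => hπ (hs.chain.onChain_of_eval hev hc.1 hc.2)⟩
  | store π x =>
    have hx := not_mem_chain (hW' rfl (.var x) (by simp))
    have hπ := hW' rfl (.path π) (by simp)
    obtain ⟨ℓ, hev, hl⟩ := hs.exists_eval (e := .path π) (hu (Or.inl rfl))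
    obtain ⟨α, hα, hv⟩ := Option.bind_eq_some_iff.1 hev
    have hne : h.get α ≠ none := by simp [hv]
    have hself : (h.write α hne (s x)).get α = some (s x) := if_pos rfl
    have hother : ∀ β, β ≠ α → (h.write α hne (s x)).get β = h.get β := fun β hβ => if_neg hβ
    have hle : ∀ k, h.Alloc k → (h.write α hne (s x)).Alloc k := by
      intro k hk f
      by_cases hb : (k, f) = α
      · rw [hb, hself]; simp
      · rw [hother _ hb]; exact hk f
    refine ⟨s, h.write α hne (s x), .single (.store hα hne hself hother), ?_⟩
    refine ⟨⟨?_, fun y hy => hle _ (hs.init y (hy.resolve_right id)), ?_, hs.locals⟩,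
      .refl _ _, hle⟩
    · intro β k hβ
      by_cases hb : β = α
      · rw [hb, hself] at hβ
        obtain rfl := Option.some.inj hβ
        exact hle _ (hs.init x (hu (Or.inr rfl)))
      · rw [hother _ hb] at hβ
        exact hle _ (hs.vals _ _ hβ)
    · intro t ht hts β
      rw [← hs.chain t ht hts β]
      by_cases hb : β = α
      · rw [hb, hself, hv]
        -- The overwritten cell is not a link: its new content is the value of `x`, its old content
        -- the value of `π`, and both expressions are off the chain.
        refine iff_of_false (fun he => hx ?_) fun he => hπ ⟨t, ht, ?_⟩
        · rw [Option.some.inj he]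
          exact ⟨List.length_pos_iff.2 ht, hts.length_le⟩
        · exact (hs.chain.eval_eq_iff ht hts).1 (hev.trans he)
      · rw [hother _ hb]
  | alloc x =>
    have hx := hW' rfl (.var x) (by simp)
    obtain ⟨ℓ, hln, hloc⟩ := h.exists_fresh fs.length
    have hl0 : ℓ ≠ nil := Nat.ne_of_gt (Nat.zero_lt_of_lt hln)
    have hself : ∀ f, (h.addObject ℓ hl0).get (ℓ, f) = some ℓ := fun f => if_pos rfl
    have hother : ∀ β, β.1 ≠ ℓ → (h.addObject ℓ hl0).get β = h.get β := fun β hβ => if_neg hβ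
    have hle : ∀ k, h.Alloc k → (h.addObject ℓ hl0).Alloc k := by
      intro k hk f
      by_cases hb : k = ℓ
      · rw [hb, hself]; simp
      · rw [hother _ hb]; exact hk f
    have hlA : (h.addObject ℓ hl0).Alloc ℓ := fun f => by rw [hself]; simp
    refine ⟨_, h.addObject ℓ hl0, .single (.alloc hl0 hloc hself hother),
      hs.update ?_ ?_ hle hlA hx fun hc => absurd hc.2 (Nat.not_le.2 hln)⟩
    · rintro ⟨k, f⟩ j hj
      by_cases hb : k = ℓ
      · rw [hb, hself] at hj
        obtain rfl := Option.some.inj hj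
        exact hlA
      · rw [hother _ hb] at hj
        exact hle _ (hs.vals _ _ hj)
    · rintro t ht hts ⟨k, f⟩
      rw [← hs.chain t ht hts]
      by_cases hb : k = ℓ
      · subst hb
        have : h.get (k, f) = none := not_not.1 fun hne => hloc ⟨f, hne⟩
        rw [hself, this]
        have := hts.length_le
        simp; omega
      · rw [hother _ hb]

/-- A call in a sound state starts its body in a sound state in which the wobbly expressions of
the callee avoid the chain if those of the caller do. -/
theorem Sound.call {Lmax : ℕ} {fs : List F} {I : Set Var} {s : Stack} {h : Heap F}
    {es : List (Exp F)} {n : ℕ} {D D' : AState F} (hs : Sound fs I s h)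
    (hes : ∀ e ∈ es, e.root ∈ I) (hn : es.length = n)
    (hW : ∀ e ∈ (absCall Lmax es D' D).W, ¬ OnChain fs s e) :
    ∃ ls, List.Forall₂ (fun e ℓ => eval s h e = some ℓ) es ls ∧
      Sound fs {x | ∃ i < n, x = Var.arg i} (frame ls) h ∧
      ∀ e ∈ D'.W, ¬ OnChain fs (frame ls) e := by
  have key : ∃ ls : List Loc, List.Forall₂ (fun e ℓ => eval s h e = some ℓ) es ls ∧
      ∀ ℓ ∈ ls, h.Alloc ℓ := by
    clear hn hW
    induction es with
    | nil => exact ⟨[], .nil, by simp⟩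
    | cons e es ih =>
      obtain ⟨ls, hls, hal⟩ := ih fun e he => hes e (List.mem_cons_of_mem _ he)
      obtain ⟨ℓ, hev, hl⟩ := hs.exists_eval (hes e List.mem_cons_self)
      exact ⟨ℓ :: ls, .cons hev hls, List.forall_mem_cons.2 ⟨hl, hal⟩⟩
  obtain ⟨ls, hls, hal⟩ := key
  refine ⟨ls, hls, ⟨hs.vals, ?_, hs.chain, ?_⟩, ?_⟩
  · rintro _ ⟨i, hi, rfl⟩
    have hi' : i < ls.length := by rwa [← hls.length_eq, hn]
    have : frame ls (.arg i) = ls[i] := by simp [frame, hi']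
    rw [this]
    exact hal _ (List.getElem_mem _)
  · rintro k ⟨t, ht, -, h2⟩
    simp only [Exp.root, frame, nil, Exp.fields, List.nil_append] at h2
    exact ht (List.length_eq_zero_iff.1 h2.symm)
  · rintro e he ⟨t, ht, hal'⟩
    have hpos : frame ls e.root ≠ 0 := by
      rw [hal'.2]
      simp [ht]
    obtain ⟨a, ha⟩ : ∃ a, actuals es e.root = some a := by
      rcases hr : e.root with i | k
      · rw [hr] at hpos
        have hi : i < ls.length := by
          by_contra hi
          exact hpos (by simp [frame, nil, Nat.le_of_not_lt hi])
        rw [← hls.length_eq] at hi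
        exact ⟨es[i], List.getElem?_eq_getElem hi⟩
      · rw [hr] at hpos
        exact absurd rfl hpos
    obtain ⟨e', he'⟩ := Exp.exists_subst ha
    have hon : OnChain fs s e' :=
      ⟨t, ht, (along_frame_iff hs.chain hls he' (by simp [ht])).1 hal'⟩
    exact hW e' (Or.inr ⟨Or.inr ⟨e, he, he'⟩, hs.isFormal hon⟩) hon

theorem CStmt.subset_initialised (C : CStmt M F) (I : Set Var) : I ⊆ C.initialised I := by
  induction C generalizing I with
  | cmd c => exact Set.subset_union_left
  | seq C c ih => exact (ih I).trans Set.subset_union_left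
  | ite C C₁ C₂ ih ih₁ ih₂ =>
    exact Set.subset_inter ((ih I).trans (ih₁ _)) ((ih I).trans (ih₂ _))
  | loop C C' ih _ => exact ih I
  | call C m es ih => exact ih I

/-- Top-level programs start in a stack without dangling variables, so the initialisation discipline
matters only in method bodies, whose locals start as `nil`. -/
theorem CStmt.initOK_univ (C : CStmt M F) : C.InitOK Set.univ := by
  have h : ∀ C : CStmt M F, C.initialised Set.univ = Set.univ :=
    fun C => Set.univ_subset_iff.1 (C.subset_initialised _)
  induction C <;> simp_all [CStmt.InitOK]

theorem Cmd.subset_wobbly (c : Cmd F) (W : Set (Exp F)) : W ⊆ c.wobbly W := by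
  cases c <;> simp [Cmd.wobbly]

/-- Through this, avoidance of the chain by the final wobbly set applies at every earlier stage. -/
theorem MethodTable.subset_analyse_W (P : MethodTable M F) (Lmax : ℕ) (C : CStmt M F)
    (D : AState F) : D.W ⊆ (P.analyse Lmax C D).W := by
  induction C generalizing D with
  | cmd c => exact c.subset_wobbly _
  | seq C c ih => exact (ih D).trans (c.subset_wobbly _)
  | ite C C₁ C₂ ih ih₁ _ => exact ((ih D).trans (ih₁ _)).trans Set.subset_union_left
  | loop C C' ih _ => exact (ih D).trans Set.subset_union_left
  | call C m es ih => exact (ih D).trans Set.subset_union_left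

/-- If the wobbly expressions avoid the chain, then all words of the program execute safely. -/
theorem Word.exec [Finite F] {P : MethodTable M F} (hP : P.WellFormed) {Lmax : ℕ}
    {C : CStmt M F} {w : List (RCmd F)} (hw : Word P C w) {b d : ℕ} {fs : List F} {I : Set Var}
    {s : Stack} {h : Heap F} {D : AState F} (S : List Stack) (hlock : Locking P Lmax b C d)
    (har : C.ArityOK P.arity) (hinit : C.InitOK I) (hs : Sound fs I s h)
    (hW : ∀ e ∈ (P.analyse Lmax C D).W, ¬ OnChain fs s e) :
    ∃ s' h', Exec Lmax w ⟨s :: S, h, b⟩ ⟨s' :: S, h', d⟩ ∧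
      Preserved fs (C.initialised I) s h s' h' := by
  induction hw generalizing b d I s h D S with
  | cmd c =>
    obtain ⟨hc⟩ := hlock
    exact c.exec_word S hc hinit hs hW
  | seq c _ ih =>
    obtain - | ⟨hC, hc⟩ := hlock
    obtain ⟨s₁, h₁, hex, hpr⟩ := ih (D := D) S hC har hinit.1 hs
      fun e he => hW e (c.subset_wobbly _ he)
    -- Avoidance is assumed for the entry stack; `SameChain` carries it over to the current one.
    obtain ⟨s₂, h₂, hex', hpr'⟩ := c.exec_word S hc hinit.2 hpr.sound
      fun e he ho => hW e he (hpr.same.onChain.1 ho)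
    exact ⟨s₂, h₂, exec_append.2 ⟨_, hex, hex'⟩, hpr.trans hpr'⟩
  | iteLeft _ _ _ ih ih' =>
    obtain - | - | ⟨hC, hC₁, hC₂⟩ := hlock
    obtain ⟨s₁, h₁, hex, hpr⟩ := ih (D := D) S hC har.1 hinit.1 hs
      fun e he => hW e (Or.inl (P.subset_analyse_W _ _ _ he))
    obtain ⟨s₂, h₂, hex', hpr'⟩ := ih' S hC₁ har.2.1 hinit.2.1 hpr.sound
      fun e he ho => hW e (Or.inl he) (hpr.same.onChain.1 ho)
    exact ⟨s₂, h₂, exec_append.2 ⟨_, hex, hex'⟩, (hpr.trans hpr').mono Set.inter_subset_left⟩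
  | iteRight _ _ _ ih ih' =>
    obtain - | - | ⟨hC, hC₁, hC₂⟩ := hlock
    obtain ⟨s₁, h₁, hex, hpr⟩ := ih (D := D) S hC har.1 hinit.1 hs
      fun e he => hW e (Or.inr (P.subset_analyse_W _ _ _ he))
    obtain ⟨s₂, h₂, hex', hpr'⟩ := ih' S hC₂ har.2.2 hinit.2.2 hpr.sound
      fun e he ho => hW e (Or.inr he) (hpr.same.onChain.1 ho)
    exact ⟨s₂, h₂, exec_append.2 ⟨_, hex, hex'⟩, (hpr.trans hpr').mono Set.inter_subset_right⟩
  | loopExit _ _ ih =>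
    obtain - | - | - | ⟨hC, hC'⟩ := hlock
    exact ih (D := D) S hC har.1 hinit.1 hs fun e he => hW e (Or.inl he)
  | loopOnce _ _ ih ih' =>
    obtain - | - | - | ⟨hC, hC'⟩ := hlock
    obtain ⟨s₁, h₁, hex, hpr⟩ := ih (D := D) S hC har.1 hinit.1 hs fun e he => hW e (Or.inl he)
    obtain ⟨s₂, h₂, hex', hpr'⟩ := ih' S hC' har.2 hinit.2 hpr.sound
      fun e he ho => hW e (Or.inr he) (hpr.same.onChain.1 ho)
    exact ⟨s₂, h₂, exec_append.2 ⟨_, hex, hex'⟩,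
      (hpr.trans hpr').mono (CStmt.subset_initialised _ _)⟩
  | @call C m w w' es _ _ ih ih' =>
    obtain - | - | - | - | ⟨hC, hm⟩ := hlock
    obtain ⟨s₁, h₁, hex, hpr⟩ := ih (D := D) S hC har.1 hinit.1 hs fun e he => hW e (Or.inl he)
    obtain ⟨ls, hls, hsound, hW'⟩ := hpr.sound.call hinit.2 har.2
      fun e he ho => hW e he (hpr.same.onChain.1 ho)
    rw [P.summary_eq] at hW'
    obtain ⟨s₂, h₂, hex', hpr'⟩ := ih' (s₁ :: S) hm (hP.arityOK m) (hP.initOK m) hsound hW'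
    -- After `pop` the frame of the caller is back unchanged. It is sound in the final heap of the
    -- callee, where the chain is intact and all earlier objects are still allocated.
    refine ⟨s₁, h₂, ?_, ⟨hpr'.sound.vals, fun x hx => hpr'.le _ (hpr.sound.init x hx),
      hpr'.sound.chain, hpr.sound.locals⟩, hpr.same, fun ℓ hl => hpr'.le _ (hpr.le _ hl)⟩
    exact exec_append.2 ⟨_, exec_append.2 ⟨_, exec_append.2 ⟨_, hex, .single (.push hls)⟩, hex'⟩,
      .single .pop⟩

/-! ## Lock contexts -/

theorem LockStep.le {Lmax b d d' : ℕ} {c : Cmd F} (h : LockStep Lmax b d c d') (hb : b ≤ d)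
    (hd : d ≤ Lmax) : b ≤ d' ∧ d' ≤ Lmax := by
  cases h <;> omega

theorem Locking.le {P : MethodTable M F} {Lmax b d : ℕ} {C : CStmt M F}
    (h : Locking P Lmax b C d) (hb : b ≤ Lmax) : b ≤ d ∧ d ≤ Lmax := by
  induction h with
  | cmd h => exact h.le le_rfl hb
  | seq _ h ih => exact h.le (ih hb).1 (ih hb).2
  | ite _ _ _ ih _ _ => exact ih hb
  | loop _ _ ih _ => exact ih hb
  | call _ _ ih _ => exact ih hb

/-- The abstract lock contexts are those of the executions, up to a shift by the number `o` of
locks that are held when the analysed method is called. -/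
theorem LockStep.abs_L {Lmax b d d' o : ℕ} {c : Cmd F} {L : ℕ}
    (h : LockStep Lmax b d c d') (ho : o ≤ b) (hL : L + o = d) : c.locking Lmax L + o = d' := by
  cases h <;> simp only [Cmd.locking, addLock] <;> omega

/-- Balance makes the contexts joined by a maximum equal. A body is analysed from context `0`, with
the depth at the call as shift, so its summary adds nothing. The cap is idle because the depth stays
within `Lmax`. -/
theorem Locking.analyse_L {P : MethodTable M F} {Lmax b d o : ℕ} {C : CStmt M F}
    (h : Locking P Lmax b C d) (hb : b ≤ Lmax) {D : AState F} (hD : D.L + o = b) :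
    (P.analyse Lmax C D).L + o = d := by
  induction h generalizing D o with
  | cmd h => exact h.abs_L (by omega) hD
  | seq hC h ih => exact h.abs_L (by omega) (ih hb hD)
  | ite hC _ _ ih ih₁ ih₂ =>
    have h0 := ih hb hD
    have h1 := ih₁ (hC.le hb).2 h0
    have h2 := ih₂ (hC.le hb).2 h0
    change max (P.analyse Lmax _ (P.analyse Lmax _ D)).L
      (P.analyse Lmax _ (P.analyse Lmax _ D)).L + o = _
    omega
  | loop hC _ ih ih' =>
    have h0 := ih hb hD
    have h1 := ih' (hC.le hb).2 h0
    change max (P.analyse Lmax _ D).L (P.analyse Lmax _ (P.analyse Lmax _ D)).L + o = _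
    omega
  | @call b d C m es hC _ ih ih' =>
    have hd := (hC.le hb).2
    have h0 := ih hb hD
    have h1 := ih' hd (D := AState.bot) (o := d) (by simp [AState.bot])
    rw [← P.summary_eq] at h1
    change addLock Lmax (P.analyse Lmax C D).L (P.summary Lmax m).L + o = d
    simp only [addLock]
    omega

/-! ## Reaching recorded accesses -/

/-- The command of an access. -/
def Access.toCmd : Access F → Cmd F
  | .load x π => .load x π
  | .store π x => .store π x

/-- The word `w` leads `C` to an access `c'` of the same kind as `c`. Wherever it executes with
`W` off the chain and `c` accessing the last cell of the chain, so does `c'`, with lock context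
`L`. -/
def Reaches (P : MethodTable M F) (Lmax b : ℕ) (C : CStmt M F) (I : Set Var) (W : Set (Exp F))
    (c : Access F) (L : ℕ) : Prop :=
  ∃ (w w' : List (RCmd F)) (c' : Access F), Word P C (w ++ .base c'.toCmd :: w') ∧
    (c'.IsStore ↔ c.IsStore) ∧
    ∀ (fs : List F) (s : Stack) (S : List Stack) (h : Heap F), Sound fs I s h →
      (∀ e ∈ W, ¬ OnChain fs s e) → Along fs s (.path c.path) [] →
      ∃ s' S' h', Exec Lmax w ⟨s :: S, h, b⟩ ⟨s' :: S', h', L⟩ ∧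
        Sound fs ∅ s' h' ∧ (∀ ℓ, h.Alloc ℓ → h'.Alloc ℓ) ∧
        Along fs s' (.path c'.path) []

/-- Later code only lengthens the part of the word behind the access, and a larger wobbly set only
strengthens the premise on the state. -/
theorem Reaches.extend {P : MethodTable M F} {Lmax b L : ℕ} {C C' : CStmt M F} {I : Set Var}
    {W W' : Set (Exp F)} {c : Access F} (H : Reaches P Lmax b C I W c L) (hW : W ⊆ W')
    {v : List (RCmd F)} (hv : ∀ w, Word P C w → Word P C' (w ++ v)) :
    Reaches P Lmax b C' I W' c L := by
  obtain ⟨w, w', c', hw, hk, hrun⟩ := H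
  exact ⟨w, w' ++ v, c', by simpa using hv _ hw, hk, fun fs s S h hs hW' hc =>
    hrun fs s S h hs (fun e he => hW' e (hW he)) hc⟩

/-- Earlier code is run by `Word.exec`, which preserves the references to the chain, so the premises
on the entry frame still hold where `C₁` starts. -/
theorem Reaches.after [Finite F] {P : MethodTable M F} (hP : P.WellFormed) {Lmax b d L : ℕ}
    {C C₁ C' : CStmt M F} {I : Set Var} {W W₁ : Set (Exp F)} {c : Access F} {D : AState F}
    (H : Reaches P Lmax d C₁ (C.initialised I) W₁ c L) (hlock : Locking P Lmax b C d)
    (har : C.ArityOK P.arity) (hinit : C.InitOK I) (hW : (P.analyse Lmax C D).W ⊆ W)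
    (hW₁ : W₁ ⊆ W) (hv : ∀ w₀ w, Word P C w₀ → Word P C₁ w → Word P C' (w₀ ++ w)) :
    Reaches P Lmax b C' I W c L := by
  obtain ⟨w, w', c', hw, hk, hrun⟩ := H
  obtain ⟨w₀, hw₀⟩ := hlock.exists_word
  refine ⟨w₀ ++ w, w', c', by simpa using hv _ _ hw₀ hw, hk, fun fs s S h hs hW' hc => ?_⟩
  obtain ⟨s₁, h₁, hex, hpr⟩ := hw₀.exec hP S hlock har hinit hs fun e he => hW' e (hW he)
  obtain ⟨s₂, S₂, h₂, hex', hs₂, hle, hal⟩ := hrun fs s₁ S h₁ hpr.sound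
    (fun e he ho => hW' e (hW₁ he) (hpr.same.onChain.1 ho))
    ((hpr.same.along (by simpa [Exp.fields] using c.path.fields_ne_nil)).2 hc)
  exact ⟨s₂, S₂, h₂, exec_append.2 ⟨_, hex, hex'⟩, hs₂, fun ℓ hl => hle _ (hpr.le _ hl), hal⟩

theorem Cmd.mem_accs {A : Set (Access F × ℕ)} {L : ℕ} {c : Cmd F} {q : Access F × ℕ}
    (hq : q ∈ c.accs A L) : q ∈ A ∨ c = q.1.toCmd ∧ q.2 = L := by
  cases c with
  | load x π =>
    rcases hq with hq | ⟨rfl, _⟩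
    · exact .inl hq
    · exact .inr ⟨rfl, rfl⟩
  | store π x =>
    rcases hq with hq | ⟨rfl, _⟩
    · exact .inl hq
    · exact .inr ⟨rfl, rfl⟩
  | _ => exact .inl hq

theorem Access.reaches (P : MethodTable M F) (Lmax b : ℕ) (I : Set Var) (W : Set (Exp F))
    (c : Access F) : Reaches P Lmax b (.cmd c.toCmd) I W c b := by
  refine ⟨[], [], c, ?_, Iff.rfl, fun fs s S h hs _ hc =>
    ⟨s, S, h, .nil, hs.mono (Set.empty_subset _), fun _ hl => hl, hc⟩⟩
  have := Word.cmd (P := P) c.toCmd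
  cases c <;> exact this

/-- Every recorded access is reached by some word. -/
theorem Locking.reaches [Finite F] {P : MethodTable M F} (hP : P.WellFormed) {Lmax b d o : ℕ}
    {C : CStmt M F} (hlock : Locking P Lmax b C d) (hb : b ≤ Lmax) {I : Set Var} {D : AState F}
    (hD : D.L + o = b) (har : C.ArityOK P.arity) (hinit : C.InitOK I) {q : Access F × ℕ}
    (hq : q ∈ (P.analyse Lmax C D).A) :
    q ∈ D.A ∨ (q.2 + o ≤ Lmax ∧
      Reaches P Lmax b C I (P.analyse Lmax C D).W q.1 (q.2 + o)) := by
  induction hlock generalizing o I D q with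
  | cmd h =>
    refine (Cmd.mem_accs hq).imp id ?_
    rintro ⟨rfl, hL⟩
    rw [hL, hD]
    exact ⟨hb, q.1.reaches ..⟩
  | @seq b d d' C c hC h ih =>
    have hL := hC.analyse_L hb hD
    rcases Cmd.mem_accs hq with hq | ⟨rfl, hqL⟩
    · exact (ih hb hD har hinit.1 hq).imp id fun H =>
        ⟨H.1, H.2.extend (c.subset_wobbly _) fun w hw => hw.seq _⟩
    · rw [(congrArg (· + o) hqL).trans hL]
      refine .inr ⟨(hC.le hb).2, (q.1.reaches P Lmax d _ ∅).after hP hC har hinit.1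
        (Cmd.subset_wobbly _ _) (Set.empty_subset _) ?_⟩
      rintro w₀ _ hw₀ ⟨⟩
      exact hw₀.seq _
  | @ite b d C C₁ C₂ hC hC₁ hC₂ ih ih₁ ih₂ =>
    have hL := hC.analyse_L hb hD
    have hd := (hC.le hb).2
    -- Both joined states contain the accesses of the common initial part `C`. For these, any word
    -- of `C₁` completes the execution.
    have hin : ∀ {q}, q ∈ (P.analyse Lmax C D).A → q ∈ D.A ∨ (q.2 + o ≤ Lmax ∧
        Reaches P Lmax b (.ite C C₁ C₂) I (P.analyse Lmax (.ite C C₁ C₂) D).W q.1 (q.2 + o)) := fun hq => (ih hb hD har.1 hinit.1 hq).imp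
      id fun H => ⟨H.1, H.2.extend ((P.subset_analyse_W _ _ _).trans Set.subset_union_left)
        fun w hw => hw.iteLeft _ hC₁.exists_word.choose_spec⟩
    rcases hq with hq | hq
    · rcases ih₁ hd hL har.2.1 hinit.2.1 hq with hq | ⟨hle, H⟩
      · exact hin hq
      · exact .inr ⟨hle, H.after hP hC har.1 hinit.1
          ((P.subset_analyse_W _ _ _).trans Set.subset_union_left) Set.subset_union_left
          fun _ _ hw₀ hw => hw₀.iteLeft _ hw⟩
    · rcases ih₂ hd hL har.2.2 hinit.2.2 hq with hq | ⟨hle, H⟩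
      · exact hin hq
      · exact .inr ⟨hle, H.after hP hC har.1 hinit.1
          ((P.subset_analyse_W _ _ _).trans Set.subset_union_right) Set.subset_union_right
          fun _ _ hw₀ hw => hw₀.iteRight _ hw⟩
  | @loop b d C C' hC hC' ih ih' =>
    have hL := hC.analyse_L hb hD
    have hd := (hC.le hb).2
    have hin : ∀ {q}, q ∈ (P.analyse Lmax C D).A → q ∈ D.A ∨ (q.2 + o ≤ Lmax ∧
        Reaches P Lmax b (.loop C C') I (P.analyse Lmax (.loop C C') D).W q.1 (q.2 + o)) := fun hq => (ih hb hD har.1 hinit.1 hq).imp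
      id fun H => ⟨H.1, H.2.extend Set.subset_union_left (v := [])
        fun w hw => by rw [List.append_nil]; exact hw.loopExit _⟩
    rcases hq with hq | hq
    · exact hin hq
    · rcases ih' hd hL har.2 hinit.2 hq with hq | ⟨hle, H⟩
      · exact hin hq
      · exact .inr ⟨hle, H.after hP hC har.1 hinit.1 Set.subset_union_left
          Set.subset_union_right fun _ _ hw₀ hw => hw₀.loopOnce hw⟩
  | @call b d C m es hC hm ih ih' =>
    have hL := hC.analyse_L hb hD
    have hd := (hC.le hb).2
    rcases hq with hq | ⟨⟨q', hq', hsub, hq2⟩, -⟩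
    · exact (ih hb hD har.1 hinit.1 hq).imp id fun H =>
        ⟨H.1, H.2.extend (v := [.push es] ++ hm.exists_word.choose ++ [.pop])
          Set.subset_union_left fun w hw => by
            simpa using hw.call es hm.exists_word.choose_spec⟩
    · rw [P.summary_eq] at hq'
      rcases ih' hd (D := AState.bot) (o := d) (by simp [AState.bot]) (hP.arityOK m)
        (hP.initOK m) hq' with hq' | ⟨hle, w, w', c', hw, hk, hrun⟩
      · exact absurd hq' (Set.notMem_empty _)
      -- The cap in the recorded context is idle by `hle`; the bound by `Lmax` is part of the
      -- induction for this purpose.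
      have hLq : q.2 + o = q'.2 + d := by
        simp only [addLock] at hq2
        change q.2 = min ((P.analyse Lmax C D).L + q'.2) Lmax at hq2
        omega
      rw [hLq]
      obtain ⟨hpath, hkind⟩ := Access.path_subst hsub
      obtain ⟨w₀, hw₀⟩ := hC.exists_word
      refine .inr ⟨hle, w₀ ++ [.push es] ++ w, w' ++ [.pop], c', by simpa using hw₀.call es hw,
        hk.trans hkind, fun fs s S h hs hW hc => ?_⟩
      obtain ⟨s₁, h₁, hex, hpr⟩ := hw₀.exec hP (D := D) S hC har.1 hinit.1 hs
        fun e he => hW e (Or.inl he)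
      obtain ⟨ls, hls, hsound, hW'⟩ := hpr.sound.call hinit.2 har.2
        fun e he ho => hW e he (hpr.same.onChain.1 ho)
      rw [P.summary_eq] at hW'
      have hc' : Along fs (frame ls) (.path q'.1.path) [] := by
        refine (along_frame_iff hpr.sound.chain hls (e' := .path q.1.path) ?_ ?_).2
          ((hpr.same.along ?_).2 hc)
        · exact Option.map_eq_some_iff.2 ⟨_, hpath, rfl⟩
        · simpa [Exp.fields] using q'.1.path.fields_ne_nil
        · simpa [Exp.fields] using q.1.path.fields_ne_nil
      obtain ⟨s₂, S₂, h₂, hex', hs₂, hle', hal⟩ := hrun fs _ (s₁ :: S) h₁ hsound hW' hc'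
      exact ⟨s₂, S₂, h₂,
        exec_append.2 ⟨_, exec_append.2 ⟨_, hex, .single (.push hls)⟩, hex'⟩, hs₂,
        fun ℓ hl => hle' _ (hpr.le _ hl), hal⟩

/-! ## Interleavings -/

/-- While the second thread does not hold the lock, the first one may run. -/
theorem Interleave.exists_left {Lmax : ℕ} {τ₁ : List (PState F)} {S S' S₂ : List Stack}
    {h h' : Heap F} {L L' : ℕ} (hex : Exec Lmax (τ₁.map PState.cmd) ⟨S, h, L⟩ ⟨S', h', L'⟩) :
    ∃ τ₀, ∀ τ₁' τ₂ τ, Interleave Lmax τ₁' τ₂ ⟨S', S₂, h', L', 0⟩ τ →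
      Interleave Lmax (τ₁ ++ τ₁') τ₂ ⟨S, S₂, h, L, 0⟩ (τ₀ ++ τ) := by
  induction τ₁ generalizing S h L with
  | nil => obtain ⟨⟩ := hex; exact ⟨[], fun _ _ _ H => H⟩
  | cons ς τ₁ ih =>
    obtain - | @⟨_, _, _, ⟨S₁, h₁, L₁⟩, _, hst, hex⟩ := hex
    obtain ⟨τ₀, hτ₀⟩ := ih hex
    exact ⟨_ :: τ₀, fun τ₁' τ₂ τ H => .stepLeft hst (.inl rfl) (hτ₀ _ _ _ H)⟩

/-- While the first thread does not hold the lock, the second one may run. -/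
theorem Interleave.exists_right {Lmax : ℕ} {τ₂ : List (PState F)} {S S' S₁ : List Stack}
    {h h' : Heap F} {L L' : ℕ} (hex : Exec Lmax (τ₂.map PState.cmd) ⟨S, h, L⟩ ⟨S', h', L'⟩) :
    ∃ τ₀, ∀ τ₁ τ₂' τ, Interleave Lmax τ₁ τ₂' ⟨S₁, S', h', 0, L'⟩ τ →
      Interleave Lmax τ₁ (τ₂ ++ τ₂') ⟨S₁, S, h, 0, L⟩ (τ₀ ++ τ) := by
  induction τ₂ generalizing S h L with
  | nil => obtain ⟨⟩ := hex; exact ⟨[], fun _ _ _ H => H⟩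
  | cons ς τ₂ ih =>
    obtain - | @⟨_, _, _, ⟨S₂, h₁, L₁⟩, _, hst, hex⟩ := hex
    obtain ⟨τ₀, hτ₀⟩ := ih hex
    exact ⟨_ :: τ₀, fun τ₁ τ₂' τ H => .stepRight hst (.inl rfl) (hτ₀ _ _ _ H)⟩

/-- Two accesses, at least one of them a store, that both threads can perform next, race if their
addresses agree. -/
theorem races_of_accesses {P : MethodTable M F} {Lmax : ℕ} {C₁ C₂ : CStmt M F} {κ₀ κ : Config₂ F}
    {τ₁ τ₁' τ₂ τ₂' : List (PState F)} {ς₁ ς₂ : PState F} {τ : List (PState₂ F)} {a₁ a₂ : Access F}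
    (hτ₁ : Trace P Lmax C₁ ⟨κ₀.stk₁, κ₀.heap, κ₀.locks₁⟩ (τ₁ ++ ς₁ :: τ₁'))
    (hτ₂ : Trace P Lmax C₂ ⟨κ₀.stk₂, κ₀.heap, κ₀.locks₂⟩ (τ₂ ++ ς₂ :: τ₂'))
    (hς₁ : ς₁.cmd = .base a₁.toCmd) (hς₂ : ς₂.cmd = .base a₂.toCmd)
    (hτ : ∀ τ', Interleave Lmax (ς₁ :: τ₁') (ς₂ :: τ₂') κ τ' →
      Interleave Lmax (τ₁ ++ ς₁ :: τ₁') (τ₂ ++ ς₂ :: τ₂') κ₀ (τ ++ τ'))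
    {s₁ s₂ : Stack} {S₁ S₂ : List Stack} {α : Addr F} (hs₁ : κ.stk₁ = s₁ :: S₁)
    (hs₂ : κ.stk₂ = s₂ :: S₂) (hα₁ : lval s₁ κ.heap a₁.path = some α)
    (hα₂ : lval s₂ κ.heap a₂.path = some α) (hst : a₁.IsStore ∨ a₂.IsStore) :
    Races P Lmax C₁ C₂ κ₀ τ := by
  -- The same pair of single-threaded traces serves all three concurrent ones: stopped before both
  -- accesses, or extended by either access without executing it.
  refine ⟨⟨_, _, hτ₁, hτ₂, by simpa using hτ [] .done⟩, κ, s₁, s₂, S₁, S₂, a₁.path, a₂.path,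
    ς₁.cmd, ς₂.cmd, α, hs₁, hs₂, hα₁, hα₂, ⟨_, _, hτ₁, hτ₂, hτ _ .nextLeft⟩,
    ⟨_, _, hτ₁, hτ₂, hτ _ .nextRight⟩, ?_⟩
  rw [hς₁, hς₂]
  rcases a₁ with ⟨x₁, π₁⟩ | ⟨π₁, x₁⟩ <;> rcases a₂ with ⟨x₂, π₂⟩ | ⟨π₂, x₂⟩
  · exact (hst.elim id id).elim
  · exact .inr (.inr ⟨⟨x₁, rfl⟩, x₂, rfl⟩)
  · exact .inr (.inl ⟨⟨x₁, rfl⟩, x₂, rfl⟩)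
  · exact .inl ⟨⟨x₁, rfl⟩, x₂, rfl⟩

/-! ## The initial state -/

open Classical in
/-- The heap that consists of the chain along `fs` and an object `fs.length + 1` to which all
fields besides the links of the chain refer. -/
noncomputable def chainHeap [Finite F] (fs : List F) : Heap F where
  get α := if α.1 = 0 ∨ fs.length + 1 < α.1 then none
    else if ∃ t, t ≠ [] ∧ α.2 :: t <:+ fs ∧ α.1 = t.length + 1 then some (α.1 - 1)
    else some (fs.length + 1)
  finite := by
    refine ((Set.finite_Iic (fs.length + 1)).prod (Set.finite_univ (α := F))).subset ?_
    intro α hα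
    refine ⟨?_, trivial⟩
    by_contra hc
    exact hα (if_pos (.inr (not_le.1 hc)))
  get_nil f := if_pos (.inl rfl)

theorem chainHeap_alloc [Finite F] {fs : List F} {ℓ : Loc} (h0 : 0 < ℓ)
    (hl : ℓ ≤ fs.length + 1) : (chainHeap fs).Alloc ℓ := by
  intro f
  have : ¬ (ℓ = 0 ∨ fs.length + 1 < ℓ) := not_or.2 ⟨h0.ne', not_lt.2 hl⟩
  simp only [chainHeap, if_neg this]
  split <;> simp

theorem chainHeap_vals [Finite F] {fs : List F} {α : Addr F} {ℓ : Loc}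
    (h : (chainHeap fs).get α = some ℓ) : (chainHeap fs).Alloc ℓ := by
  simp only [chainHeap] at h
  split at h
  · cases h
  · rename_i hα
    split at h
    · rename_i ht
      obtain ⟨t, ht, -, hl⟩ := ht
      have := List.length_pos_iff.2 ht
      obtain rfl := Option.some.inj h
      rw [not_or, not_lt] at hα
      refine chainHeap_alloc ?_ ((Nat.sub_le _ _).trans hα.2)
      rw [hl]
      exact this
    · obtain rfl := Option.some.inj h
      exact chainHeap_alloc (Nat.succ_pos _) le_rfl

/-- The sink has a number greater than the length of any suffix, so the cells that hold it are no
references to the chain. -/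
theorem chainHeap_chain [Finite F] (fs : List F) : ChainHeap fs (chainHeap fs) := by
  rintro t ht hts ⟨ℓ, f⟩
  have h0 := List.length_pos_iff.2 ht
  constructor
  · intro h
    simp only [chainHeap] at h
    split at h
    · cases h
    · split at h
      · rename_i hu
        obtain ⟨u, hu, hus, hl⟩ := hu
        have hlen := Option.some.inj h
        rw [hl, Nat.add_sub_cancel] at hlen
        obtain rfl := suffix_eq_of_length ((List.suffix_cons _ _).trans hus) hts hlen
        exact ⟨f, hus, by rw [hl]⟩
      · have h1 : fs.length + 1 = t.length := Option.some.inj h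
        have := hts.length_le
        omega
  · rintro ⟨g, hg, he⟩
    obtain ⟨rfl, rfl⟩ := Prod.mk.inj he
    have hlen := hg.length_le
    rw [List.length_cons] at hlen
    have h1 : ¬ (t.length + 1 = 0 ∨ fs.length + 1 < t.length + 1) := by omega
    simp only [chainHeap, if_neg h1]
    rw [if_pos ⟨t, ht, hg, rfl⟩]
    rfl

/-- The stack in which `x` refers to the chain along `fs` and nothing else does. -/
def chainStack (fs : List F) (x : Var) : Stack :=
  fun y => if y = x then fs.length else fs.length + 1

theorem chainStack_alloc [Finite F] {fs : List F} (hfs : fs ≠ []) (x y : Var) :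
    (chainHeap fs).Alloc (chainStack fs x y) := by
  unfold chainStack
  split
  · exact chainHeap_alloc (List.length_pos_iff.2 hfs) (Nat.le_succ _)
  · exact chainHeap_alloc (Nat.succ_pos _) le_rfl

/-- Variables other than `x` hold a number too large for a suffix, and `x` holds `fs.length`, which
only the whole of `fs` attains. -/
theorem root_eq_of_along {fs : List F} {x : Var} {e : Exp F} {t : List F}
    (h : Along fs (chainStack fs x) e t) : e.root = x ∧ e.fields ++ t = fs := by
  have hx : e.root = x := by
    by_contra hx
    have h2 : fs.length + 1 = (e.fields ++ t).length := by rw [← h.2, chainStack, if_neg hx]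
    have h3 := h.1.length_le
    omega
  refine ⟨hx, h.1.eq_of_length ?_⟩
  rw [← h.2, chainStack, if_pos hx]

theorem sound_chainStack [Finite F] {fs : List F} (hfs : fs ≠ []) {x : Var} (hx : x.IsFormal) :
    Sound fs Set.univ (chainStack fs x) (chainHeap fs) where
  vals _ _ h := chainHeap_vals h
  init y _ := chainStack_alloc hfs x y
  chain := chainHeap_chain fs
  locals n := by
    rintro ⟨t, -, h⟩
    rw [← (root_eq_of_along h).1] at hx
    exact hx

theorem wellBehaved_chain [Finite F] [Nonempty F] {fs : List F} (hfs : fs ≠ []) (x₁ x₂ : Var)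
    (L₁ L₂ : ℕ) :
    WellBehaved ⟨[chainStack fs x₁], [chainStack fs x₂], chainHeap fs, L₁, L₂⟩ := by
  have hloc : ∀ {ℓ}, (chainHeap fs).Alloc ℓ → ℓ ∈ (chainHeap fs).locs :=
    fun h => ⟨Classical.arbitrary F, h _⟩
  refine ⟨?_, fun α ℓ h => hloc (chainHeap_vals h)⟩
  intro s hs y
  simp only [List.cons_append, List.nil_append, List.mem_cons, List.not_mem_nil, or_false] at hs
  rcases hs with rfl | rfl <;> exact hloc (chainStack_alloc hfs _ y)

theorem along_chainStack (π : Path F) :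
    Along π.fields (chainStack π.fields π.root) (.path π) [] := by
  simp [Along, Exp.fields, Exp.root, chainStack]

/-- The remaining suffix is nonempty, which excludes `π` itself. The accessed path may thus be
wobbly, as its own access makes it when it is recorded directly. -/
theorem properPrefix_of_onChain {π : Path F} {e : Exp F}
    (h : OnChain π.fields (chainStack π.fields π.root) e) : e.ProperPrefix (.path π) := by
  obtain ⟨t, ht, h⟩ := h
  obtain ⟨hr, hf⟩ := root_eq_of_along h
  refine ⟨⟨hr, t, hf⟩, ?_⟩
  rintro rfl
  exact ht (List.self_eq_append_right.1 hf.symm)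

theorem Cmd.isFormal_of_mem_accs {A : Set (Access F × ℕ)} {L : ℕ} (c : Cmd F)
    (hA : ∀ q ∈ A, q.1.path.root.IsFormal) : ∀ q ∈ c.accs A L, q.1.path.root.IsFormal := by
  cases c with
  | load | store => exact fun q hq => hq.elim (hA q) fun h => h.2
  | _ => exact hA

/-- The variable that holds the chain initially has to be a formal, since `Sound` keeps locals off
the chain. -/
theorem isFormal_of_mem_analyse {P : MethodTable M F} {Lmax : ℕ} {C : CStmt M F} {D : AState F}
    (hD : ∀ q ∈ D.A, q.1.path.root.IsFormal) :
    ∀ q ∈ (P.analyse Lmax C D).A, q.1.path.root.IsFormal := by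
  induction C generalizing D with
  | cmd c => exact c.isFormal_of_mem_accs hD
  | seq C c ih => exact c.isFormal_of_mem_accs (ih hD)
  | ite C C₁ C₂ ih ih₁ ih₂ => exact fun q hq => hq.elim (ih₁ (ih hD) q) (ih₂ (ih hD) q)
  | loop C C' ih ih' => exact fun q hq => hq.elim (ih hD q) (ih' (ih hD) q)
  | call C m es ih => exact fun q hq => hq.elim (ih hD q) fun h => h.2

end

end RacerDX

theorem theorem2 {M F : Type*} [Finite F] (P : MethodTable M F) (hP : P.WellFormed)
    (Lmax : ℕ) (hLmax : 0 < Lmax) (C₁ C₂ : CStmt M F)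
    (hC₁ : C₁.ArityOK P.arity) (hC₂ : C₂.ArityOK P.arity)
    (hb₁ : BalancedLocking P Lmax C₁) (hb₂ : BalancedLocking P Lmax C₂)
    (W₁ W₂ : Set (Exp F)) (K₁ K₂ : ℕ) (A₁ A₂ : Set (Access F × ℕ))
    (hD₁ : P.analyse Lmax C₁ AState.bot = ⟨W₁, K₁, A₁⟩)
    (hD₂ : P.analyse Lmax C₂ AState.bot = ⟨W₂, K₂, A₂⟩)
    (c₁ c₂ : Access F) (L₁ L₂ : ℕ) (hA₁ : (c₁, L₁) ∈ A₁) (hA₂ : (c₂, L₂) ∈ A₂)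
    (hfields : c₁.path.fields = c₂.path.fields)
    (hW₁ : ∀ e ∈ W₁, ¬ e.ProperPrefix (.path c₁.path))
    (hW₂ : ∀ e ∈ W₂, ¬ e.ProperPrefix (.path c₂.path))
    (hstore : c₁.IsStore ∨ c₂.IsStore)
    (hL : L₁ + L₂ ≤ 1) :
    ∃ (s₁ s₂ : Stack) (h : Heap F), WellBehaved ⟨[s₁], [s₂], h, 0, 0⟩ ∧
      ∃ τ : List (PState₂ F), Races P Lmax C₁ C₂ ⟨[s₁], [s₂], h, 0, 0⟩ τ := by
  have hfs := c₁.path.fields_ne_nil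
  have : Nonempty F := ⟨c₁.path.fields.head hfs⟩
  obtain ⟨fs, s₁, hfs₁, hs₁⟩ : ∃ fs s, fs = c₁.path.fields ∧ s = chainStack fs c₁.path.root :=
    ⟨_, _, rfl, rfl⟩
  obtain ⟨s₂, hs₂⟩ : ∃ s, s = chainStack fs c₂.path.root := ⟨_, rfl⟩
  rw [← hfs₁] at hfs
  have hfs₂ := hfs₁.trans hfields
  refine ⟨s₁, s₂, chainHeap fs, by rw [hs₁, hs₂]; exact wellBehaved_chain hfs _ _ _ _, ?_⟩
  -- The part of one thread. Trace and access are fixed before the heap `h`, so that they also serve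
  -- in the heap left by the other thread.
  have key : ∀ (C : CStmt M F) (W : Set (Exp F)) (K : ℕ) (A : Set (Access F × ℕ)) (c : Access F)
      (L : ℕ) (s : Stack), C.ArityOK P.arity → BalancedLocking P Lmax C →
      P.analyse Lmax C AState.bot = ⟨W, K, A⟩ → (c, L) ∈ A → fs = c.path.fields →
      (∀ e ∈ W, ¬ e.ProperPrefix (.path c.path)) → s = chainStack fs c.path.root →
      ∃ (τ τ' : List (PState F)) (ς : PState F) (c' : Access F),
        Trace P Lmax C ⟨[s], chainHeap fs, 0⟩ (τ ++ ς :: τ') ∧ ς.cmd = .base c'.toCmd ∧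
        (c'.IsStore ↔ c.IsStore) ∧ Sound fs Set.univ s (chainHeap fs) ∧
        ∀ h, Sound fs Set.univ s h →
          ∃ s' S' h', Exec Lmax (τ.map PState.cmd) ⟨[s], h, 0⟩ ⟨s' :: S', h', L⟩ ∧
            Sound fs ∅ s' h' ∧ (∀ ℓ, h.Alloc ℓ → h'.Alloc ℓ) ∧ Along fs s' (.path c'.path) [] := by
    rintro C W K A c L s har hb hD hA rfl hW rfl
    have hA' : (c, L) ∈ (P.analyse Lmax C AState.bot).A := by rw [hD]; exact hA
    have hW' : ∀ e ∈ (P.analyse Lmax C AState.bot).W,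
        ¬ OnChain c.path.fields (chainStack c.path.fields c.path.root) e := by
      rw [hD]
      exact fun e he ho => hW e he (properPrefix_of_onChain ho)
    have hroot : c.path.root.IsFormal :=
      isFormal_of_mem_analyse (fun q hq => absurd hq (Set.notMem_empty q)) _ hA'
    have hs := sound_chainStack hfs hroot
    rcases hb.reaches hP (Nat.zero_le _) (o := 0) rfl har C.initOK_univ hA' with
      hq | ⟨-, w, w', c', hw, hk, hrun⟩
    · exact absurd hq (Set.notMem_empty _)
    -- Interleavings are formed from complete executions, so the whole word has to run from the
    -- initial state, including what follows the access.
    obtain ⟨_, _, hex, -⟩ := hw.exec hP [] hb har C.initOK_univ hs hW'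
    obtain ⟨τ, hτ, hm, -⟩ := hw.exists_trace hex
    obtain ⟨τ₀, τ₁, rfl, rfl, hm₁⟩ := List.map_eq_append_iff.1 hm
    obtain ⟨ς, τ', rfl, hς, -⟩ := List.map_eq_cons_iff.1 hm₁
    exact ⟨τ₀, τ', ς, c', hτ, hς, hk, hs, fun h hsh =>
      hrun _ _ [] h hsh hW' (along_chainStack _)⟩
  obtain ⟨τ₁, τ₁', ς₁, a₁, htr₁, hς₁, hk₁, hsound₁, hrun₁⟩ :=
    key C₁ W₁ K₁ A₁ c₁ L₁ s₁ hC₁ hb₁ hD₁ hA₁ hfs₁ hW₁ hs₁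
  obtain ⟨τ₂, τ₂', ς₂, a₂, htr₂, hς₂, hk₂, hsound₂, hrun₂⟩ :=
    key C₂ W₂ K₂ A₂ c₂ L₂ s₂ hC₂ hb₂ hD₂ hA₂ hfs₂ hW₂ hs₂
  have hst : a₁.IsStore ∨ a₂.IsStore := by rwa [hk₁, hk₂]
  have haddr : ∀ (h : Heap F) (s s' : Stack) (π π' : Path F), ChainHeap fs h →
      Along fs s (.path π) [] → Along fs s' (.path π') [] →
      ∃ α, lval s h π = some α ∧ lval s' h π' = some α := by
    intro h s s' π π' hh hπ hπ'
    obtain ⟨f, hf, hl⟩ := hh.lval_eq hπ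
    obtain ⟨f', hf', hl'⟩ := hh.lval_eq hπ'
    obtain rfl : f = f' := List.singleton_inj.1 (suffix_eq_of_length hf hf' rfl)
    exact ⟨_, hl, hl'⟩
  -- The thread that has not started keeps its stack `s`; only the heap comes from the other
  -- thread's run.
  have hnext : ∀ {s s' : Stack} {h : Heap F}, Sound fs Set.univ s (chainHeap fs) →
      Sound fs ∅ s' h → (∀ ℓ, (chainHeap fs).Alloc ℓ → h.Alloc ℓ) → Sound fs Set.univ s h :=
    fun hs hs' hle => ⟨hs'.vals, fun x hx => hle _ (hs.init x hx), hs'.chain, hs.locals⟩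
  -- The thread with context `0` at its access goes first. It then waits without holding the lock,
  -- so the other one may acquire it.
  obtain rfl | rfl : L₁ = 0 ∨ L₂ = 0 := by omega
  · obtain ⟨t₁, T₁, h₁, hex₁, hso₁, hle₁, hal₁⟩ := hrun₁ _ hsound₁
    obtain ⟨t₂, T₂, h₂, hex₂, hso₂, -, hal₂⟩ := hrun₂ _ (hnext hsound₂ hso₁ hle₁)
    obtain ⟨α, hα₁, hα₂⟩ := haddr h₂ _ _ _ _ hso₂.chain hal₁ hal₂
    obtain ⟨ρ₁, hρ₁⟩ := Interleave.exists_left (S₂ := [s₂]) hex₁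
    obtain ⟨ρ₂, hρ₂⟩ := Interleave.exists_right (S₁ := t₁ :: T₁) hex₂
    exact ⟨ρ₁ ++ ρ₂, races_of_accesses htr₁ htr₂ hς₁ hς₂
      (fun τ' H => by rw [List.append_assoc]; exact hρ₁ _ _ _ (hρ₂ _ _ _ H))
      rfl rfl hα₁ hα₂ hst⟩
  · obtain ⟨t₂, T₂, h₂, hex₂, hso₂, hle₂, hal₂⟩ := hrun₂ _ hsound₂
    obtain ⟨t₁, T₁, h₁, hex₁, hso₁, -, hal₁⟩ := hrun₁ _ (hnext hsound₁ hso₂ hle₂)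
    obtain ⟨α, hα₁, hα₂⟩ := haddr h₁ _ _ _ _ hso₁.chain hal₁ hal₂
    obtain ⟨ρ₂, hρ₂⟩ := Interleave.exists_right (S₁ := [s₁]) hex₂
    obtain ⟨ρ₁, hρ₁⟩ := Interleave.exists_left (S₂ := t₂ :: T₂) hex₁
    exact ⟨ρ₂ ++ ρ₁, races_of_accesses htr₁ htr₂ hς₁ hς₂
      (fun τ' H => by rw [List.append_assoc]; exact hρ₂ _ _ _ (hρ₁ _ _ _ H))
      rfl rfl hα₁ hα₂ hst⟩
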